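/- Let $A$ be a unital commutative complex Banach algebra whose invertible elements are dense in $A$ and whose set of squares $\{a^2 : a \in A\}$ is dense in $A$. Then the maximal ideal space of $A$ (the space of nonzero multiplicative linear functionals $A \to \mathbb{C}$ with the Gelfand, i.e. weak-$*$, topology) contains no compact, locally connected subspace of Lebesgue covering dimension $\geq 2$ (dimension $\infty$ included). -/

import Mathlib

/-- A topological space has Lebesgue covering dimension less than `n` if every finite open cover
has an open refinement (again a cover) such that every point lies in at most `n` members of the
refinement, i.e. a refinement of order at most `n - 1`. For `n = 0` this says that the space is
empty. -/
def HasCoveringDimensionLT (X : Type*) [TopologicalSpace X] (n : ℕ) : Prop :=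
  ∀ U : Set (Set X), U.Finite → (∀ u ∈ U, IsOpen u) → ⋃₀ U = Set.univ →
    ∃ V : Set (Set X), (∀ v ∈ V, IsOpen v) ∧ ⋃₀ V = Set.univ ∧
      (∀ v ∈ V, ∃ u ∈ U, v ⊆ u) ∧ ∀ x : X, {v ∈ V | x ∈ v}.encard ≤ n

/-- The Lebesgue covering dimension of a topological space, with value `⊥` for the empty space
(in place of the traditional `-1`) and `⊤` for infinite-dimensional spaces. -/
noncomputable def coveringDimension (X : Type*) [TopologicalSpace X] : WithBot ℕ∞ :=
  sInf {d : WithBot ℕ∞ | ∀ n : ℕ, d < n → HasCoveringDimensionLT X n}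

open Set Filter Topology MeasureTheory

/-! A compact Hausdorff space has covering dimension at most one as soon as zero-free functions are
uniformly dense in its continuous complex functions (`DenseNonvanishing.hasCoveringDimensionLT`).
Components of a locally connected space are open, so this density may be checked on one component
`X` of the given set of characters. Transforms of invertible elements have no zeros on `X`, so it is
enough that they are dense in `C(X, ℂ)`.

Let `B` be the closure of the Gelfand transforms restricted to `X`. Density of squares gives every
invertible element roots of all orders `2 ^ n`; on `X` these roots force a continuous logarithm `α`
with `exp (t α) ∈ B` for all `t ≥ 0`. As invertible elements are dense, such exponentials are dense
in `B`, and the heart of the proof is that a closed separating algebra with this property is all of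
`C(X, ℂ)` (`eq_top_of_dense_exponentials`).

If `f x₀ = 1` and `f x₁ = 0`, the ratio `-c / (1 - c)` of the values of `f - c` has no continuous
logarithm on the circle `‖c‖ = 1/2`. Hence for some `g = f - c` there are approximating exponentials
whose logarithms have different increments from `x₀` to `x₁`. Interpolating between them yields `g v
∈ B` with `v` locally constant off the zeros of `g`, `v x₀ = 1` and `v x₁ = -1`; then `g + g v`
vanishes near `x₁` but not at `x₀`.

Small powers of exponentials and Cesàro means turn such functions into indicators that separate
neighbourhoods of points, so every continuous function lies in the bounded pointwise closure of `B`.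
By dominated convergence it is an `L¹(ν)`-limit of elements of `B` for each finite measure `ν`,
whereas Hahn–Banach and Riesz give any `φ ∉ B` a `ν` for which its distance to `B` is positive. -/

/-! ### Zero-free approximation and covering dimension at most one. -/

/-- Every continuous complex function is uniformly close to a nowhere vanishing one. -/
def DenseNonvanishing (X : Type*) [TopologicalSpace X] : Prop :=
  ∀ f : C(X, ℂ), ∀ ε > 0, ∃ g : C(X, ℂ), (∀ x, g x ≠ 0) ∧ ∀ x, ‖g x - f x‖ < ε

/-- A nonvanishing perturbation may be taken to leave the function unchanged away from its
zeros. -/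
theorem DenseNonvanishing.exists_eq_of_le_norm {X : Type*} [TopologicalSpace X]
    (hX : DenseNonvanishing X) (f : C(X, ℂ)) {δ : ℝ} (hδ : 0 < δ) :
    ∃ h : C(X, ℂ), (∀ x, h x ≠ 0) ∧ ∀ x, δ ≤ ‖f x‖ → h x = f x := by
  obtain ⟨g, hg0, hg⟩ := hX f (δ / 2) (by positivity)
  -- A cutoff equal to `0` where `‖f‖ ≤ δ/2` and to `1` where `‖f‖ ≥ δ`. In between, `f` exceeds the
  -- correction, whose norm is below `δ/2`.
  let s : X → ℝ := fun x => min 1 (max 0 (2 * ‖f x‖ / δ - 1))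
  have hs : Continuous s := by fun_prop
  refine ⟨⟨fun x => f x + ((1 - s x : ℝ) : ℂ) * (g x - f x), by fun_prop⟩, fun x => ?_,
    fun x hx => ?_⟩
  · by_cases h : ‖f x‖ ≤ δ / 2
    · have : s x = 0 := by
        have : 2 * ‖f x‖ / δ - 1 ≤ 0 := by
          rw [sub_nonpos, div_le_one hδ]; linarith
        simp [s, max_eq_left this]
      simpa [this] using hg0 x
    · push Not at h
      have h1 : ‖((1 - s x : ℝ) : ℂ) * (g x - f x)‖ ≤ ‖g x - f x‖ := by
        rw [norm_mul, Complex.norm_real, Real.norm_eq_abs]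
        refine mul_le_of_le_one_left (norm_nonneg _) ?_
        rw [abs_le]
        constructor
        · linarith [min_le_left (1 : ℝ) (max 0 (2 * ‖f x‖ / δ - 1))]
        · have : 0 ≤ s x := le_min zero_le_one (le_max_left _ _)
          linarith
      intro h0
      have h2 : f x = -(((1 - s x : ℝ) : ℂ) * (g x - f x)) := eq_neg_of_add_eq_zero_left h0
      have h3 := congrArg norm h2
      rw [norm_neg] at h3
      linarith [hg x]
  · have : s x = 1 := by
      have : 1 ≤ 2 * ‖f x‖ / δ - 1 := by
        rw [le_sub_iff_add_le, le_div_iff₀ hδ]; linarith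
      simp only [s, min_eq_left_iff]
      exact this.trans (le_max_right _ _)
    simp [this]

/-- Open covers by three sets have open shrinkings with empty intersection. -/
theorem DenseNonvanishing.exists_shrinking {X : Type*} [TopologicalSpace X] [CompactSpace X]
    [T2Space X] (hX : DenseNonvanishing X) (U : Fin 3 → Set X) (hU : ∀ i, IsOpen (U i))
    (hcov : ⋃ i, U i = univ) :
    ∃ W : Fin 3 → Set X, (∀ i, IsOpen (W i)) ∧ (⋃ i, W i = univ) ∧ (∀ i, W i ⊆ U i) ∧
      W 0 ∩ W 1 ∩ W 2 = ∅ := by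
  obtain ⟨p, hp⟩ := PartitionOfUnity.exists_isSubordinate (isClosed_univ (X := X)) U hU
    (by rw [hcov])
  have hnn : ∀ i x, 0 ≤ p i x := fun i x => p.nonneg i x
  have hsum : ∀ x, p 0 x + p 1 x + p 2 x = 1 := fun x => by
    have := p.sum_eq_one (mem_univ x)
    rwa [finsum_eq_sum_of_fintype, Fin.sum_univ_three] at this
  have hpU : ∀ i x, x ∉ U i → p i x = 0 := fun i x hx => by
    by_contra h
    exact hx (hp i (subset_tsupport _ h))
  -- The two differences vanish together only where all three `p i` equal `1/3`, which cannot happen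
  -- off some `U i`.
  let f : C(X, ℂ) := ⟨fun x => ((p 0 x - p 1 x : ℝ) : ℂ) + ((p 1 x - p 2 x : ℝ) : ℂ) * Complex.I,
    by fun_prop⟩
  have hre : ∀ x, (f x).re = p 0 x - p 1 x := fun x => by simp [f]
  have him : ∀ x, (f x).im = p 1 x - p 2 x := fun x => by simp [f]
  have hf : ∀ i x, x ∉ U i → 1 / 4 ≤ ‖f x‖ := by
    intro i x hx
    have h0 := hpU i x hx
    have h1 := abs_le.1 (Complex.abs_re_le_norm (f x))
    have h2 := abs_le.1 (Complex.abs_im_le_norm (f x))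
    rw [hre] at h1
    rw [him] at h2
    have h3 := hsum x
    fin_cases i <;> simp at h0 <;> linarith [h1.1, h1.2, h2.1, h2.2]
  obtain ⟨h, hh0, hhf⟩ := hX.exists_eq_of_le_norm f (δ := 1 / 4) (by norm_num)
  have hreo : Continuous fun x => (h x).re := by fun_prop
  have himo : Continuous fun x => (h x).im := by fun_prop
  -- Read `h` as `(q₀ - q₁) + (q₁ - q₂) I`: the set `W i` says that `q i` exceeds another
  -- coordinate. A least coordinate never does, so the triple intersection is empty; a greatest one
  -- does unless all agree, that is `h = 0`. Off `U i`, `h = f` and `p i = 0` is least.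
  refine ⟨![{x | 0 < (h x).re} ∪ {x | 0 < (h x).re + (h x).im},
    {x | (h x).re < 0} ∪ {x | 0 < (h x).im},
    {x | (h x).re + (h x).im < 0} ∪ {x | (h x).im < 0}], fun i => ?_, ?_, fun i x hx => ?_, ?_⟩
  · fin_cases i
    · exact (isOpen_lt continuous_const hreo).union (isOpen_lt continuous_const (hreo.add himo))
    · exact (isOpen_lt hreo continuous_const).union (isOpen_lt continuous_const himo)
    · exact (isOpen_lt (hreo.add himo) continuous_const).union (isOpen_lt himo continuous_const)
  · refine eq_univ_of_forall fun x => mem_iUnion.2 ?_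
    rcases lt_trichotomy (h x).re 0 with h1 | h1 | h1
    · exact ⟨1, Or.inl h1⟩
    · rcases lt_trichotomy (h x).im 0 with h2 | h2 | h2
      · exact ⟨2, Or.inr h2⟩
      · exact absurd (Complex.ext h1 h2) (hh0 x)
      · exact ⟨1, Or.inr h2⟩
    · exact ⟨0, Or.inl h1⟩
  · by_contra hxU
    have h0 := hpU i x hxU
    have h1 := hhf x (hf i x hxU)
    have h2 := hre x
    have h3 := him x
    rw [← h1] at h2 h3
    have n0 := hnn 0 x
    have n1 := hnn 1 x
    have n2 := hnn 2 x
    fin_cases i <;> simp at h0 hx <;> rcases hx with hx | hx <;> linarith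
  · ext x
    simp only [Matrix.cons_val_zero, Matrix.cons_val_one, Matrix.cons_val, mem_inter_iff,
      mem_union, mem_ofPred_eq, mem_empty_iff_false, iff_false]
    rintro ⟨⟨h1 | h1, h2 | h2⟩, h3 | h3⟩ <;> linarith

/-- Triples are treated one at a time: all sets other than `W i` and `W j` are merged into one, the
three-set case is applied, and the third piece is cut back to each `W l`. Shrinking preserves the
intersections already made empty. -/
theorem DenseNonvanishing.exists_shrinking_finset {X : Type*} [TopologicalSpace X]
    [CompactSpace X] [T2Space X] (hX : DenseNonvanishing X) {ι : Type*} (U : ι → Set X)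
    (hU : ∀ i, IsOpen (U i)) (hcov : ⋃ i, U i = univ) (T : Finset (ι × ι × ι))
    (hT : ∀ t ∈ T, t.1 ≠ t.2.1 ∧ t.1 ≠ t.2.2 ∧ t.2.1 ≠ t.2.2) :
    ∃ W : ι → Set X, (∀ i, IsOpen (W i)) ∧ (⋃ i, W i = univ) ∧ (∀ i, W i ⊆ U i) ∧
      ∀ t ∈ T, W t.1 ∩ W t.2.1 ∩ W t.2.2 = ∅ := by
  classical
  induction T using Finset.induction_on with
  | empty => exact ⟨U, hU, hcov, fun _ => Subset.rfl, by simp⟩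
  | insert t T _ ih =>
    obtain ⟨W, hWo, hWc, hWU, hWT⟩ := ih fun t ht => hT t (Finset.mem_insert_of_mem ht)
    obtain ⟨i, j, k⟩ := t
    obtain ⟨hij, hik, hjk⟩ := hT _ (Finset.mem_insert_self _ _)
    simp only at hij hik hjk
    obtain ⟨S, hSo, hSc, hSW, hS⟩ := hX.exists_shrinking
      ![W i, W j, ⋃ l ∈ ({i, j}ᶜ : Set ι), W l] (fun n => by
        fin_cases n
        · exact hWo i
        · exact hWo j
        · exact isOpen_biUnion fun l _ => hWo l) (by
        refine eq_univ_of_forall fun x => ?_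
        obtain ⟨l, hl⟩ := mem_iUnion.1 (hWc.symm ▸ mem_univ x : x ∈ ⋃ i, W i)
        by_cases hi : l = i
        · exact mem_iUnion.2 ⟨0, hi ▸ hl⟩
        by_cases hj : l = j
        · exact mem_iUnion.2 ⟨1, hj ▸ hl⟩
        · exact mem_iUnion.2 ⟨2, mem_biUnion (by simp [hi, hj]) hl⟩)
    have hS0 : S 0 ⊆ W i := hSW 0
    have hS1 : S 1 ⊆ W j := hSW 1
    have hS2 : S 2 ⊆ ⋃ l ∈ ({i, j}ᶜ : Set ι), W l := hSW 2
    let W' : ι → Set X := fun l => if l = i then S 0 else if l = j then S 1 else S 2 ∩ W l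
    have hi' : W' i = S 0 := by simp [W']
    have hj' : W' j = S 1 := by simp [W', hij.symm]
    have hl' : ∀ l, l ≠ i → l ≠ j → W' l = S 2 ∩ W l := fun l h1 h2 => by simp [W', h1, h2]
    have hW'W : ∀ l, W' l ⊆ W l := fun l => by
      by_cases h1 : l = i
      · subst h1; rwa [hi']
      by_cases h2 : l = j
      · subst h2; rwa [hj']
      · rw [hl' l h1 h2]; exact inter_subset_right
    refine ⟨W', fun l => ?_, eq_univ_of_forall fun x => ?_, fun l => (hW'W l).trans (hWU l), ?_⟩
    · by_cases h1 : l = i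
      · subst h1; rw [hi']; exact hSo 0
      by_cases h2 : l = j
      · subst h2; rw [hj']; exact hSo 1
      · rw [hl' l h1 h2]; exact (hSo 2).inter (hWo l)
    · obtain ⟨n, hn⟩ := mem_iUnion.1 (hSc.symm ▸ mem_univ x : x ∈ ⋃ i, S i)
      fin_cases n
      · exact mem_iUnion.2 ⟨i, hi'.symm ▸ hn⟩
      · exact mem_iUnion.2 ⟨j, hj'.symm ▸ hn⟩
      · obtain ⟨l, hl, hxl⟩ := mem_iUnion₂.1 (hS2 hn)
        simp only [mem_compl_iff, mem_insert_iff, mem_singleton_iff, not_or] at hl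
        exact mem_iUnion.2 ⟨l, (hl' l hl.1 hl.2).symm ▸ ⟨hn, hxl⟩⟩
    · intro t ht
      rcases Finset.mem_insert.1 ht with rfl | ht
      · simp only
        rw [hi', hj', hl' k hik.symm hjk.symm, eq_empty_iff_forall_notMem]
        rintro x ⟨⟨h0, h1⟩, h2, -⟩
        exact (eq_empty_iff_forall_notMem.1 hS) x ⟨⟨h0, h1⟩, h2⟩
      · exact subset_empty_iff.1 ((inter_subset_inter (inter_subset_inter (hW'W _) (hW'W _))
          (hW'W _)).trans (hWT t ht).subset)

theorem DenseNonvanishing.hasCoveringDimensionLT {X : Type*} [TopologicalSpace X]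
    [CompactSpace X] [T2Space X] (hX : DenseNonvanishing X) : HasCoveringDimensionLT X 2 := by
  classical
  intro U hUf hUo hUc
  have := hUf.to_subtype
  have := Fintype.ofFinite U
  obtain ⟨W, hWo, hWc, hWU, hW⟩ := hX.exists_shrinking_finset (fun u : U => (u : Set X))
    (fun u => hUo u u.2) (by rw [← sUnion_eq_iUnion, hUc])
    {t | t.1 ≠ t.2.1 ∧ t.1 ≠ t.2.2 ∧ t.2.1 ≠ t.2.2} (fun t ht => by simpa using ht)
  refine ⟨range W, ?_, by rw [sUnion_range, hWc], ?_, fun x => ?_⟩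
  · rintro _ ⟨u, rfl⟩; exact hWo u
  · rintro _ ⟨u, rfl⟩; exact ⟨u, u.2, hWU u⟩
  · by_contra! h
    -- Three distinct members through `x` come from three distinct indices, a triple with empty
    -- intersection.
    have h3 : (3 : ℕ∞) ≤ {v ∈ range W | x ∈ v}.encard := by
      have := Order.add_one_le_of_lt h
      rwa [show ((2 : ℕ) : ℕ∞) + 1 = 3 by norm_num] at this
    obtain ⟨t, ht, ht3⟩ := exists_subset_encard_eq h3
    obtain ⟨a, b, c, hab, hac, hbc, rfl⟩ := encard_eq_three.1 ht3
    obtain ⟨⟨i, rfl⟩, hi⟩ := ht (by simp : a ∈ ({a, b, c} : Set (Set X)))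
    obtain ⟨⟨j, rfl⟩, hj⟩ := ht (by simp : b ∈ ({W i, b, c} : Set (Set X)))
    obtain ⟨⟨k, rfl⟩, hk⟩ := ht (by simp : c ∈ ({W i, W j, c} : Set (Set X)))
    have := hW (i, j, k) (by
      simp only [Finset.mem_filter, Finset.mem_univ, true_and]
      exact ⟨fun h => hab (h ▸ rfl), fun h => hac (h ▸ rfl), fun h => hbc (h ▸ rfl)⟩)
    exact (eq_empty_iff_forall_notMem.1 this) x ⟨⟨hi, hj⟩, hk⟩

theorem HasCoveringDimensionLT.mono {X : Type*} [TopologicalSpace X] {m n : ℕ} (hmn : m ≤ n)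
    (h : HasCoveringDimensionLT X m) : HasCoveringDimensionLT X n := fun U h1 h2 h3 => by
  obtain ⟨V, hV1, hV2, hV3, hV4⟩ := h U h1 h2 h3
  exact ⟨V, hV1, hV2, hV3, fun x => (hV4 x).trans (by exact_mod_cast hmn)⟩

theorem coveringDimension_le_one {X : Type*} [TopologicalSpace X]
    (h : HasCoveringDimensionLT X 2) : coveringDimension X ≤ 1 := by
  refine sInf_le fun n hn => h.mono ?_
  have : (1 : ℕ) < n := by exact_mod_cast hn
  exact this

/-! ### Reduction to connected components. -/

/-- Nonvanishing functions are dense if they are so on each connected component. -/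
theorem DenseNonvanishing.of_connectedComponent {X : Type*} [TopologicalSpace X]
    [LocallyConnectedSpace X] (h : ∀ x : X, DenseNonvanishing (connectedComponent x)) :
    DenseNonvanishing X := by
  intro f ε hε
  choose g hg0 hg using fun x : X => h x (f.restrict _) ε hε
  -- A fixed representative of each component, so that only one approximant per component is used;
  -- the pieces glue because components are open.
  let r : X → X := fun x => (ConnectedComponents.mk x).out
  have hr : ∀ x, x ∈ connectedComponent (r x) := fun x => by
    exact ConnectedComponents.coe_eq_coe'.1 (Quotient.out_eq' (ConnectedComponents.mk x)).symm
  let G : X → ℂ := fun x => g (r x) ⟨x, hr x⟩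
  have hG : Continuous G := by
    rw [continuous_iff_continuousAt]
    intro x
    have hopen : IsOpen (connectedComponent (r x)) := isOpen_connectedComponent
    have h1 : ContinuousOn G (connectedComponent (r x)) := by
      rw [continuousOn_iff_continuous_domRestrict]
      convert (g (r x)).continuous using 1
      ext y
      have : r y = r x := by
        have h2 : ConnectedComponents.mk (y : X) = ConnectedComponents.mk x := by
          rw [ConnectedComponents.coe_eq_coe']
          have := connectedComponent_eq (hr x)
          rw [← this]; exact y.2
        simp only [r, h2]
      have key : ∀ a b : X, a = b → ∀ (ha : (y : X) ∈ connectedComponent a)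
          (hb : (y : X) ∈ connectedComponent b), g a ⟨y, ha⟩ = g b ⟨y, hb⟩ := by
        rintro a _ rfl _ _; rfl
      exact key _ _ this _ _
    exact h1.continuousAt (hopen.mem_nhds (hr x))
  exact ⟨⟨G, hG⟩, fun x => hg0 _ _, fun x => hg _ _⟩

/-! ### Roots of invertible elements. -/

/-- Squaring is open at `1`, its derivative there being multiplication by `2`, so elements near `1`
are squares. For a square `g ^ 2` close to the unit `u`, `u⁻¹ g ^ 2 = s ^ 2`, whence `u = (g s⁻¹) ^
2`. -/
theorem exists_sq_eq_of_isUnit {A : Type*} [NormedCommRing A] [NormedAlgebra ℂ A]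
    [CompleteSpace A] (hsq : Dense (range fun a : A => a ^ 2)) {a : A} (ha : IsUnit a) :
    ∃ r : A, IsUnit r ∧ r ^ 2 = a := by
  have h1 : map (fun x : A => x * x) (𝓝 1) = 𝓝 (1 * 1) := by
    have := (hasStrictFDerivAt_id (𝕜 := ℂ) (1 : A)).mul (hasStrictFDerivAt_id (𝕜 := ℂ) (1 : A))
    refine this.map_nhds_eq_of_surj (LinearMap.range_eq_top.2 fun y => ⟨(1 / 2 : ℂ) • y, ?_⟩)
    simp [← add_smul]
    norm_num
  rw [mul_one] at h1
  have h2 : ∀ᶠ y in 𝓝 (1 : A), IsUnit y ∧ ∃ s, s * s = y := by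
    have hu : ∀ᶠ y in 𝓝 (1 : A), IsUnit y := Units.isOpen.mem_nhds isUnit_one
    refine hu.and ?_
    rw [← h1]
    exact mem_map.2 (univ_mem' fun s => ⟨s, rfl⟩)
  obtain ⟨u, rfl⟩ := ha
  have h3 : Tendsto (fun x : A => (↑u⁻¹ : A) * x) (𝓝 u) (𝓝 1) := by
    have : Continuous fun x : A => (↑u⁻¹ : A) * x := by fun_prop
    simpa using this.tendsto (u : A)
  obtain ⟨_, ⟨hy, s, hs⟩, g, rfl⟩ := mem_closure_iff_nhds.1 (hsq (u : A)) _ (h3.eventually h2)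
  simp only at hs hy
  have hus : IsUnit s := isUnit_of_mul_isUnit_left (hs ▸ hy)
  obtain ⟨s, rfl⟩ := hus
  have h4 : g ^ 2 = u * (s * s : A) := by rw [hs]; simp
  have h5 : (g * (↑s⁻¹ : A)) ^ 2 = u := by
    rw [mul_pow, h4, mul_assoc, ← pow_two, ← mul_pow]; simp
  exact ⟨_, (isUnit_pow_iff two_ne_zero).1 (h5 ▸ u.isUnit), h5⟩

theorem exists_two_pow_root_of_isUnit {A : Type*} [NormedCommRing A] [NormedAlgebra ℂ A]
    [CompleteSpace A] (hsq : Dense (range fun a : A => a ^ 2)) (n : ℕ) {a : A} (ha : IsUnit a) :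
    ∃ r : A, r ^ 2 ^ n = a := by
  induction n generalizing a with
  | zero => exact ⟨a, by simp⟩
  | succ n ih =>
    obtain ⟨s, hs, rfl⟩ := exists_sq_eq_of_isUnit hsq ha
    obtain ⟨r, rfl⟩ := ih hs
    exact ⟨r, by rw [pow_succ, pow_mul]⟩

/-! ### Continuous logarithms from roots, through limits along an ultrafilter. -/

/-- A continuous function on a connected set whose exponential stays near one stays near its
value at any one point. -/
theorem IsPreconnected.norm_sub_le_of_norm_exp_sub_one_le {X : Type*} [TopologicalSpace X]
    {N : Set X} (hN : IsPreconnected N) {γ : X → ℂ} (hγ : ContinuousOn γ N) {y : X} (hy : y ∈ N)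
    {η : ℝ} (hη : η ≤ 1 / 2) (h : ∀ x ∈ N, ‖Complex.exp (γ x - γ y) - 1‖ ≤ η) :
    ∀ x ∈ N, ‖γ x - γ y‖ ≤ 3 / 2 * η := by
  -- The imaginary part starts at `0` and cannot cross `±π/2`, so the principal logarithm inverts
  -- `exp` throughout `N`.
  have hcos : ∀ x ∈ N, Real.cos (γ x - γ y).im ≠ 0 := by
    intro x hx h0
    have h1 := abs_le.1 ((Complex.abs_re_le_norm _).trans (h x hx))
    rw [Complex.sub_re, Complex.exp_re, h0, mul_zero, Complex.one_re] at h1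
    linarith [h1.1]
  have hord : ((fun x => (γ x - γ y).im) '' N).OrdConnected :=
    (hN.image _ (by fun_prop)).ordConnected
  have h0 : (0 : ℝ) ∈ (fun x => (γ x - γ y).im) '' N := ⟨y, hy, by simp⟩
  intro x hx
  have hx' : (γ x - γ y).im ∈ (fun x => (γ x - γ y).im) '' N := ⟨x, hx, rfl⟩
  have hlt : (γ x - γ y).im < Real.pi / 2 := by
    by_contra! hge
    obtain ⟨z, hz, hz'⟩ := hord.out h0 hx' ⟨by positivity, hge⟩
    exact hcos z hz (by simp only at hz'; rw [hz', Real.cos_pi_div_two])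
  have hgt : -(Real.pi / 2) < (γ x - γ y).im := by
    by_contra! hge
    obtain ⟨z, hz, hz'⟩ := hord.out hx' h0 ⟨hge, by linarith [Real.pi_pos]⟩
    exact hcos z hz (by simp only at hz'; rw [hz', Real.cos_neg, Real.cos_pi_div_two])
  have hlog : Complex.log (Complex.exp (γ x - γ y)) = γ x - γ y :=
    Complex.log_exp (by linarith [Real.pi_pos]) (by linarith [Real.pi_pos])
  have h2 := Complex.norm_log_one_add_half_le_self ((h x hx).trans hη)
  rw [add_sub_cancel, hlog] at h2
  linarith [h x hx]

/-- Functions that become locally constant along an ultrafilter converge to a locally constant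
function, uniformly on compact sets. -/
theorem Ultrafilter.exists_locallyConstant_limit {X ι : Type*} [TopologicalSpace X]
    (l : Ultrafilter ι) (ξ : ι → X → ℂ) (U : Set X)
    (hU : ∀ y ∈ U, ∃ N ∈ 𝓝 y, ∀ ε > 0, ∀ᶠ i in (l : Filter ι), ∀ x ∈ N, ‖ξ i x - ξ i y‖ ≤ ε)
    (hb : ∀ y ∈ U, ∃ C, ∀ᶠ i in (l : Filter ι), ‖ξ i y‖ ≤ C) :
    ∃ v : X → ℂ, (∀ y ∈ U, ∀ᶠ x in 𝓝 y, v x = v y) ∧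
      (∀ y ∈ U, Tendsto (fun i => ξ i y) l (𝓝 (v y))) ∧
      ∀ K ⊆ U, IsCompact K → TendstoUniformlyOn ξ v l K := by
  -- Off `U` the limit may not exist and `v` is then an arbitrary value; nothing is claimed about it
  -- there.
  let v : X → ℂ := fun x => limUnder (l : Filter ι) fun i => ξ i x
  have hlim : ∀ y ∈ U, Tendsto (fun i => ξ i y) l (𝓝 (v y)) := by
    intro y hy
    obtain ⟨C, hC⟩ := hb y hy
    obtain ⟨z, -, hz⟩ := (isCompact_closedBall (0 : ℂ) C).ultrafilter_le_nhds
      (l.map fun i => ξ i y) (by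
        rw [le_principal_iff, Ultrafilter.coe_map, Filter.mem_map]
        filter_upwards [hC] with i hi
        simpa using hi)
    have hz' : Tendsto (fun i => ξ i y) l (𝓝 z) := hz
    simpa only [v, hz'.limUnder_eq] using hz'
  have hconst : ∀ y ∈ U, ∃ N ∈ 𝓝 y, (∀ x ∈ N, v x = v y) ∧
      ∀ ε > 0, ∀ᶠ i in (l : Filter ι), ∀ x ∈ N, ‖ξ i x - v y‖ ≤ ε := by
    intro y hy
    obtain ⟨N, hN, hNε⟩ := hU y hy
    have hunif : ∀ ε > 0, ∀ᶠ i in (l : Filter ι), ∀ x ∈ N, ‖ξ i x - v y‖ ≤ ε := by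
      intro ε hε
      filter_upwards [hNε (ε / 2) (by positivity),
        (Metric.tendsto_nhds.1 (hlim y hy)) (ε / 2) (by positivity)] with i h1 h2 x hx
      rw [dist_eq_norm] at h2
      calc ‖ξ i x - v y‖ = ‖(ξ i x - ξ i y) + (ξ i y - v y)‖ := by ring_nf
        _ ≤ ε / 2 + ε / 2 := (norm_add_le _ _).trans (add_le_add (h1 x hx) h2.le)
        _ = ε := by ring
    refine ⟨N, hN, fun x hx => Tendsto.limUnder_eq ?_, hunif⟩
    rw [Metric.tendsto_nhds]
    intro ε hε
    filter_upwards [hunif (ε / 2) (by positivity)] with i hi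
    rw [dist_eq_norm]
    linarith [hi x hx]
  refine ⟨v, fun y hy => ?_, hlim, fun K hK hKc => ?_⟩
  · obtain ⟨N, hN, h, -⟩ := hconst y hy
    exact mem_of_superset hN h
  · rw [← tendstoLocallyUniformlyOn_iff_tendstoUniformlyOn_of_compact hKc,
      Metric.tendstoLocallyUniformlyOn_iff]
    intro ε hε y hy
    obtain ⟨N, hN, h, h'⟩ := hconst y (hK hy)
    refine ⟨N, mem_nhdsWithin_of_mem_nhds hN, ?_⟩
    filter_upwards [h' (ε / 2) (by positivity)] with i hi x hx
    rw [h x hx, dist_comm, dist_eq_norm]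
    linarith [hi x hx]

theorem IsPreconnected.eq_of_pow_eq_one {X : Type*} [TopologicalSpace X] {N : Set X}
    (hN : IsPreconnected N) {ζ : X → ℂ} (hζ : ContinuousOn ζ N) {n : ℕ} (hn : 0 < n)
    (h : ∀ x ∈ N, ζ x ^ n = 1) {x y : X} (hx : x ∈ N) (hy : y ∈ N) : ζ x = ζ y := by
  have hfin : {z : ℂ | z ^ n = 1}.Finite := by
    refine (Polynomial.nthRoots n (1 : ℂ)).toFinset.finite_toSet.subset fun z hz => ?_
    simpa [Polynomial.mem_nthRoots hn] using hz
  exact hN.constant_of_mapsTo hfin.isDiscrete hζ h hx hy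

/-- A nonvanishing function with continuous roots of all orders `2 ^ n` has a continuous
logarithm. -/
theorem exists_continuous_log {X : Type*} [TopologicalSpace X] [CompactSpace X]
    [ConnectedSpace X] [LocallyConnectedSpace X] (f : C(X, ℂ)) (hf : ∀ x, f x ≠ 0)
    (r : ℕ → C(X, ℂ)) (hr : ∀ n x, r n x ^ 2 ^ n = f x) :
    ∃ α : C(X, ℂ), ∀ x, Complex.exp (α x) = f x := by
  have hr0 : ∀ n x, r n x ≠ 0 := fun n x h => hf x (by rw [← hr n x, h, zero_pow (by positivity)])
  have hpow : ∀ n : ℕ, 2 ^ n ≠ 0 := fun n => by positivity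
  have hub : ∀ n x, ‖r n x‖ ≤ 1 + ‖f x‖ := by
    intro n x
    rcases le_total ‖r n x‖ 1 with h | h
    · linarith [norm_nonneg (f x)]
    · have := le_self_pow₀ h (hpow n)
      rw [← norm_pow, hr] at this
      linarith
  have hlb : ∀ n x, min 1 ‖f x‖ ≤ ‖r n x‖ := by
    intro n x
    rcases le_total ‖r n x‖ 1 with h | h
    · have := pow_le_of_le_one (norm_nonneg _) h (hpow n)
      rw [← norm_pow, hr] at this
      exact (min_le_right _ _).trans this
    · exact (min_le_left _ _).trans h
  obtain ⟨v, hvc, hvl, hvu⟩ := (hyperfilter ℕ).exists_locallyConstant_limit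
    -- On a small connected `N` all roots have the form `r n y * exp (log (f x / f y) / 2 ^ n)`,
    -- since two `2 ^ n`-th roots differ by a locally constant root of unity. The second factor
    -- tends uniformly to `1`.
    (fun n x => r n x) univ (fun y _ => by
      have hnhds : {x | ‖f x / f y - 1‖ < 1 / 2} ∈ 𝓝 y := by
        have : Continuous fun x => ‖f x / f y - 1‖ := by fun_prop
        exact (isOpen_lt this continuous_const).mem_nhds (by simp [hf y])
      obtain ⟨N, ⟨hNo, hyN, hNc⟩, hN⟩ :=
        (LocallyConnectedSpace.open_connected_basis y).mem_iff.1 hnhds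
      refine ⟨N, hNo.mem_nhds hyN, fun ε hε => ?_⟩
      have hsl : ∀ x ∈ N, f x / f y ∈ Complex.slitPlane := fun x hx => by
        have := Complex.mem_slitPlane_of_norm_lt_one (z := f x / f y - 1)
          (lt_trans (hN hx) (by norm_num))
        simpa using this
      have hLn : ∀ x ∈ N, ‖Complex.log (f x / f y)‖ ≤ 1 := fun x hx => by
        have h1 : ‖f x / f y - 1‖ < 1 / 2 := hN hx
        have := Complex.norm_log_one_add_half_le_self h1.le
        rw [add_sub_cancel] at this
        linarith
      have hLc : ContinuousOn (fun x => Complex.log (f x / f y)) N :=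
        ContinuousOn.clog (by fun_prop) hsl
      have hform : ∀ n, ∀ x ∈ N,
          r n x = r n y * Complex.exp (Complex.log (f x / f y) / 2 ^ n) := by
        intro n x hx
        have hone := hNc.isPreconnected.eq_of_pow_eq_one
          (ζ := fun x => r n x / r n y * Complex.exp (-(Complex.log (f x / f y) / 2 ^ n)))
          (by fun_prop) (n := 2 ^ n) (by positivity) (fun x hx => by
            rw [mul_pow, div_pow, hr, hr, ← Complex.exp_nat_mul]
            rw [show ((2 ^ n : ℕ) : ℂ) * -(Complex.log (f x / f y) / 2 ^ n)
              = -Complex.log (f x / f y) by push_cast; field_simp]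
            rw [Complex.exp_neg, Complex.exp_log (div_ne_zero (hf x) (hf y))]
            exact mul_inv_cancel₀ (div_ne_zero (hf x) (hf y))) hx hyN
        simp only [div_self (hr0 n y), div_self (hf y), Complex.log_one, zero_div, neg_zero,
          Complex.exp_zero, mul_one] at hone
        rw [Complex.exp_neg] at hone
        have he := Complex.exp_ne_zero (Complex.log (f x / f y) / 2 ^ n)
        have hy0 := hr0 n y
        field_simp at hone
        rw [hone]
      have htend : Tendsto (fun n : ℕ => (1 + ‖f y‖) * (2 * (1 / 2 : ℝ) ^ n)) (hyperfilter ℕ)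
          (𝓝 0) := by
        have h1 := tendsto_pow_atTop_nhds_zero_of_lt_one (r := (1 / 2 : ℝ)) (by norm_num)
          (by norm_num)
        have h2 := (h1.const_mul 2).const_mul (1 + ‖f y‖)
        simp only [mul_zero] at h2
        exact h2.mono_left (by rw [← Nat.cofinite_eq_atTop]; exact hyperfilter_le_cofinite)
      filter_upwards [htend.eventually (ge_mem_nhds hε)] with n hn x hx
      rw [hform n x hx, ← mul_sub_one, norm_mul]
      have h3 : ‖Complex.log (f x / f y) / 2 ^ n‖ ≤ (1 / 2) ^ n := by
        rw [norm_div, norm_pow, Complex.norm_ofNat, div_pow, one_pow]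
        gcongr
        exact hLn x hx
      have h4 := Complex.norm_exp_sub_one_le (h3.trans (pow_le_one₀ (by norm_num) (by norm_num)))
      refine le_trans ?_ hn
      gcongr
      · exact hub n y
      · linarith) (fun y _ => ⟨1 + ‖f y‖, Eventually.of_forall fun n => hub n y⟩)
  have hv : IsLocallyConstant v := (IsLocallyConstant.iff_eventually_eq v).2 fun y => hvc y trivial
  obtain ⟨y⟩ : Nonempty X := inferInstance
  have hvy : ∀ x, v x = v y := fun x => hv.apply_eq_of_preconnectedSpace x y
  have hv0 : 0 < ‖v y‖ := by
    refine lt_of_lt_of_le (lt_min one_pos (norm_pos_iff.2 (hf y)))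
      (ge_of_tendsto (hvl y trivial).norm (Eventually.of_forall fun n => hlb n y))
  -- By connectedness `v` is a nonzero constant. One root `r n` within `‖v y‖` of it already has a
  -- principal logarithm after division by `v y`; multiplying that by `2 ^ n` recovers a logarithm
  -- of `f`.
  obtain ⟨n, hn⟩ := (Metric.tendstoUniformlyOn_iff.1 (hvu univ Subset.rfl isCompact_univ) _
    hv0).exists
  have hsl : ∀ x, r n x / v y ∈ Complex.slitPlane := fun x => by
    have h1 := hn x trivial
    rw [hvy x, dist_comm, dist_eq_norm] at h1
    have := Complex.mem_slitPlane_of_norm_lt_one (z := r n x / v y - 1) (by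
      rw [div_sub_one (norm_pos_iff.1 hv0), norm_div, div_lt_one hv0]; exact h1)
    simpa using this
  refine ⟨⟨fun x => (2 ^ n : ℕ) * Complex.log (r n x / v y) + Complex.log (v y ^ 2 ^ n), ?_⟩,
    fun x => ?_⟩
  · have : Continuous fun x => Complex.log (r n x / v y) :=
      Continuous.clog (by fun_prop) hsl
    fun_prop
  · have hvn := norm_pos_iff.1 hv0
    simp only [ContinuousMap.coe_mk]
    rw [Complex.exp_add, Complex.exp_nat_mul, Complex.exp_log (div_ne_zero (hr0 n x) hvn),
      Complex.exp_log (pow_ne_zero _ hvn), div_pow, hr, div_mul_cancel₀ _ (pow_ne_zero _ hvn)]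

/-! ### Generators of exponential semigroups in a closed algebra. -/

/-- The pointwise exponential of a continuous function. -/
noncomputable def ContinuousMap.cexp {X : Type*} [TopologicalSpace X] (α : C(X, ℂ)) : C(X, ℂ) :=
  ⟨fun x => Complex.exp (α x), by fun_prop⟩

@[simp] theorem ContinuousMap.cexp_apply {X : Type*} [TopologicalSpace X] (α : C(X, ℂ)) (x : X) :
    α.cexp x = Complex.exp (α x) := rfl

/-- The continuous functions which generate a one-parameter semigroup of exponentials in `B`. -/
def expGenerators {X : Type*} [TopologicalSpace X] (B : Subalgebra ℂ C(X, ℂ)) : Set C(X, ℂ) :=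
  {α | ∀ t : ℝ, 0 ≤ t → ((t : ℂ) • α).cexp ∈ B}

theorem cexp_mem_of_mem_expGenerators {X : Type*} [TopologicalSpace X]
    {B : Subalgebra ℂ C(X, ℂ)} {α : C(X, ℂ)} (hα : α ∈ expGenerators B) : α.cexp ∈ B := by
  simpa using hα 1 zero_le_one

theorem cexp_combination_mem {X : Type*} [TopologicalSpace X]
    {B : Subalgebra ℂ C(X, ℂ)} {α β : C(X, ℂ)} (hα : α ∈ expGenerators B)
    (hβ : β ∈ expGenerators B) {s t : ℝ} (hs : 0 ≤ s) (ht : 0 ≤ t) (c : ℂ) :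
    ((s : ℂ) • α + (t : ℂ) • β + ContinuousMap.const X c).cexp ∈ B := by
  have h := B.smul_mem (B.mul_mem (hα s hs) (hβ t ht)) (Complex.exp c)
  convert h using 1
  ext x
  simp [Complex.exp_add]
  ring

/-- The functions `exp (α / 2 ^ n)` and `r n` are `2 ^ n`-th roots of the same `f`, hence
proportional on a connected space. So `B` contains `exp (t α)` for dyadic `t ≥ 0`, and for all `t ≥
0` by closedness. -/
theorem exists_mem_expGenerators_cexp_eq {X : Type*} [TopologicalSpace X] [CompactSpace X]
    [ConnectedSpace X] [LocallyConnectedSpace X] {B : Subalgebra ℂ C(X, ℂ)}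
    (hB : IsClosed (B : Set C(X, ℂ))) (f : C(X, ℂ)) (hf : ∀ x, f x ≠ 0)
    (hroot : ∀ n : ℕ, ∃ r ∈ B, r ^ 2 ^ n = f) : ∃ α ∈ expGenerators B, α.cexp = f := by
  choose r hrB hr using hroot
  have hr' : ∀ n x, r n x ^ 2 ^ n = f x := fun n x => by rw [← hr n]; rfl
  obtain ⟨α, hα⟩ := exists_continuous_log f hf r hr'
  refine ⟨α, fun t ht => ?_, ContinuousMap.ext hα⟩
  have hr0 : ∀ n x, r n x ≠ 0 := fun n x h =>
    hf x (by rw [← hr' n x, h, zero_pow (by positivity)])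
  have hdy : ∀ n : ℕ, (((1 / 2 ^ n : ℝ) : ℂ) • α).cexp ∈ B := by
    intro n
    obtain ⟨y⟩ : Nonempty X := inferInstance
    have hc : ∀ x, Complex.exp (α x / 2 ^ n) / r n x = Complex.exp (α y / 2 ^ n) / r n y :=
      fun x => isPreconnected_univ.eq_of_pow_eq_one (n := 2 ^ n)
        (ζ := fun x => Complex.exp (α x / 2 ^ n) / r n x)
        (by
          have : Continuous fun x => Complex.exp (α x / 2 ^ n) / r n x :=
            Continuous.div (by fun_prop) (by fun_prop) (hr0 n)
          exact this.continuousOn) (by positivity) (fun x _ => by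
          rw [div_pow, hr', ← Complex.exp_nat_mul,
            show ((2 ^ n : ℕ) : ℂ) * (α x / 2 ^ n) = α x by push_cast; field_simp, hα,
            div_self (hf x)]) trivial trivial
    convert B.smul_mem (hrB n) (Complex.exp (α y / 2 ^ n) / r n y) using 1
    ext x
    have := hc x
    rw [div_eq_iff (hr0 n x)] at this
    simp only [ContinuousMap.cexp_apply, ContinuousMap.smul_apply, smul_eq_mul]
    rw [← this]
    congr 1
    push_cast
    ring
  have hmul : ∀ n j : ℕ, (((j / 2 ^ n : ℝ) : ℂ) • α).cexp ∈ B := by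
    intro n j
    convert B.pow_mem (hdy n) j using 1
    ext x
    simp only [ContinuousMap.cexp_apply, ContinuousMap.smul_apply, ContinuousMap.pow_apply,
      smul_eq_mul, ← Complex.exp_nat_mul]
    congr 1
    push_cast
    ring
  have hcont : Continuous fun s : ℝ => ((s : ℂ) • α).cexp := by
    refine ContinuousMap.continuous_of_continuous_uncurry _ ?_
    simp only [Function.uncurry_def, ContinuousMap.cexp_apply, ContinuousMap.smul_apply,
      smul_eq_mul]
    fun_prop
  have hlim : Tendsto (fun n : ℕ => (⌊t * 2 ^ n⌋₊ : ℝ) / 2 ^ n) atTop (𝓝 t) :=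
    (tendsto_nat_floor_mul_div_atTop ht).comp (tendsto_pow_atTop_atTop_of_one_lt one_lt_two)
  exact hB.mem_of_tendsto ((hcont.tendsto t).comp hlim)
    (Eventually.of_forall fun n => hmul n _)

theorem hyperfilter_le_atTop : ((hyperfilter ℕ : Ultrafilter ℕ) : Filter ℕ) ≤ atTop := by
  rw [← Nat.cofinite_eq_atTop]; exact hyperfilter_le_cofinite

/-! ### Functions in the algebra that vanish near one point and not at another. -/

/-- Connected neighbourhoods on which a nonvanishing function is nearly constant. -/
theorem exists_connected_nhds_norm_sub_lt {X : Type*} [TopologicalSpace X]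
    [LocallyConnectedSpace X] (g : C(X, ℂ)) {y : X} (hy : g y ≠ 0) {δ : ℝ} (hδ : 0 < δ) :
    ∃ N ∈ 𝓝 y, IsPreconnected N ∧ y ∈ N ∧ ∀ x ∈ N, ‖g x - g y‖ < δ * ‖g y‖ := by
  have hnhds : {x | ‖g x - g y‖ < δ * ‖g y‖} ∈ 𝓝 y := by
    have : Continuous fun x => ‖g x - g y‖ := by fun_prop
    refine (isOpen_lt this continuous_const).mem_nhds ?_
    have := norm_pos_iff.2 hy
    show ‖g y - g y‖ < _
    rw [sub_self, norm_zero]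
    positivity
  obtain ⟨N, ⟨hNo, hyN, hNc⟩, hN⟩ :=
    (LocallyConnectedSpace.open_connected_basis y).mem_iff.1 hnhds
  exact ⟨N, hNo.mem_nhds hyN, hNc.isPreconnected, hyN, hN⟩

theorem norm_div_sub_one_le {p q : ℂ} {κ : ℝ} (hp : ‖p - 1‖ ≤ κ) (hq : ‖q - 1‖ ≤ κ)
    (hκ : κ ≤ 1 / 2) : ‖p / q - 1‖ ≤ 4 * κ := by
  have h1 : 1 / 2 ≤ ‖q‖ := by
    have := norm_sub_norm_le (1 : ℂ) (1 - q)
    rw [sub_sub_cancel, norm_one, norm_sub_rev] at this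
    linarith
  have hq0 : q ≠ 0 := norm_pos_iff.1 (by linarith)
  rw [div_sub_one hq0, norm_div, div_le_iff₀ (by linarith)]
  have h2 : ‖p - q‖ ≤ κ + κ := by
    calc ‖p - q‖ = ‖(p - 1) - (q - 1)‖ := by ring_nf
      _ ≤ _ := (norm_sub_le _ _).trans (add_le_add hp hq)
  have h3 : 0 ≤ κ := (norm_nonneg _).trans hp
  nlinarith

/-- Two sequences of exponentials in `B` with the same limit `g`, whose logarithms have different
increments between two points, give an element of `B` that separates these points. -/
theorem exists_mem_eventually_eq_zero_of_jump {X : Type*} [TopologicalSpace X] [CompactSpace X]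
    [LocallyConnectedSpace X] {B : Subalgebra ℂ C(X, ℂ)}
    (hB : IsClosed (B : Set C(X, ℂ))) {g : C(X, ℂ)} {x₀ x₁ : X} (h0 : g x₀ ≠ 0) (h1 : g x₁ ≠ 0)
    {α β : ℕ → C(X, ℂ)} (hα : ∀ n, α n ∈ expGenerators B) (hβ : ∀ n, β n ∈ expGenerators B)
    (hαg : Tendsto (fun n => (α n).cexp) atTop (𝓝 g))
    (hβg : Tendsto (fun n => (β n).cexp) atTop (𝓝 g))
    (hjump : ∀ n, 3 ≤ ‖(α n x₁ - α n x₀) - (β n x₁ - β n x₀)‖) :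
    ∃ G ∈ B, G x₀ ≠ 0 ∧ ∀ᶠ x in 𝓝 x₁, G x = 0 := by
  have hgB : g ∈ B := hB.mem_of_tendsto hαg
    (Eventually.of_forall fun n => cexp_mem_of_mem_expGenerators (hα n))
  let γ : ℕ → X → ℂ := fun n x => α n x - β n x
  have hexp : ∀ n x, Complex.exp (γ n x) = (α n).cexp x / (β n).cexp x := fun n x => by
    simp [γ, Complex.exp_sub]
  have hαu := Metric.tendstoUniformly_iff.1 (ContinuousMap.tendsto_iff_tendstoUniformly.1 hαg)
  have hβu := Metric.tendstoUniformly_iff.1 (ContinuousMap.tendsto_iff_tendstoUniformly.1 hβg)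
  have hγ1 : ∀ y, g y ≠ 0 → Tendsto (fun n => Complex.exp (γ n y)) atTop (𝓝 1) := by
    intro y hy
    simp only [hexp]
    have ha := ((continuous_eval_const (F := C(X, ℂ)) y).tendsto g).comp hαg
    have hb := ((continuous_eval_const (F := C(X, ℂ)) y).tendsto g).comp hβg
    have := ha.div hb hy
    rwa [div_self hy] at this
  have hre : ∀ y, g y ≠ 0 → Tendsto (fun n => (γ n y).re) atTop (𝓝 0) := by
    intro y hy
    have h2 := ((hγ1 y hy).norm).log (by simp)
    simpa [Complex.norm_exp] using h2
  let z : ℕ → ℂ := fun n => γ n x₁ - γ n x₀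
  have hz3 : ∀ n, 3 ≤ ‖z n‖ := fun n => by
    have h2 : z n = (α n x₁ - α n x₀) - (β n x₁ - β n x₀) := by simp only [z, γ]; ring
    rw [h2]; exact hjump n
  have hzexp : Tendsto (fun n => Complex.exp (z n)) atTop (𝓝 1) := by
    have := (hγ1 x₁ h1).div (hγ1 x₀ h0) one_ne_zero
    simp only [div_one] at this
    refine this.congr fun n => ?_
    simp only [z, Complex.exp_sub, Pi.div_apply]
  have hzre : Tendsto (fun n => (z n).re) atTop (𝓝 0) := by
    simpa [z] using (hre x₁ h1).sub (hre x₀ h0)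
  -- Otherwise `z n` is the principal logarithm of a number tending to `1`, hence small, against `3
  -- ≤ ‖z n‖`.
  have hzim : ∀ᶠ n in atTop, Real.pi ≤ |(z n).im| := by
    have h2 : Tendsto (fun n => ‖Complex.log (Complex.exp (z n))‖) atTop (𝓝 0) := by
      have := (hzexp.clog (by simp)).norm
      simpa using this
    filter_upwards [h2.eventually (gt_mem_nhds (by norm_num : (0 : ℝ) < 3))] with n hn
    by_contra! hlt
    rw [abs_lt] at hlt
    rw [Complex.log_exp hlt.1 hlt.2.le] at hn
    linarith [hz3 n]
  -- Chosen to bring the imaginary part of `t n * z n` to `±π`, so that the interpolated exponential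
  -- changes sign between `x₀` and `x₁`.
  let t : ℕ → ℝ := fun n => min 1 (Real.pi / |(z n).im|)
  have ht0 : ∀ n, 0 ≤ t n := fun n => le_min zero_le_one (by positivity)
  have ht1 : ∀ n, t n ≤ 1 := fun n => min_le_left _ _
  have htz : Tendsto (fun n => Complex.exp (t n * z n)) atTop (𝓝 (-1)) := by
    have h2 : Tendsto (fun n => t n * (z n).re) atTop (𝓝 0) := by
      refine squeeze_zero_norm (fun n => ?_) (tendsto_zero_iff_norm_tendsto_zero.1 hzre)
      rw [norm_mul, Real.norm_of_nonneg (ht0 n)]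
      exact mul_le_of_le_one_left (norm_nonneg _) (ht1 n)
    have h3 : Tendsto (fun n => -Complex.exp ((t n * (z n).re : ℝ) : ℂ)) atTop (𝓝 (-1)) := by
      have := ((Complex.continuous_ofReal.tendsto 0).comp h2).cexp.neg
      simpa using this
    refine h3.congr' ?_
    filter_upwards [hzim] with n hn
    have hpos : 0 < |(z n).im| := Real.pi_pos.trans_le hn
    have htn : t n = Real.pi / |(z n).im| := min_eq_right ((div_le_one hpos).2 hn)
    have h4 : (t n : ℂ) * z n = ((t n * (z n).re : ℝ) : ℂ)
        + ((t n * (z n).im : ℝ) : ℂ) * Complex.I := by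
      conv_lhs => rw [← Complex.re_add_im (z n)]
      push_cast
      ring
    rw [h4, Complex.exp_add]
    have h5 : Complex.exp (((t n * (z n).im : ℝ) : ℂ) * Complex.I) = -1 := by
      rcases abs_choice (z n).im with h | h
      · have : t n * (z n).im = Real.pi := by
          rw [htn]; conv_lhs => rw [← h]
          rw [abs_abs, div_mul_cancel₀ _ hpos.ne']
        rw [this, Complex.exp_pi_mul_I]
      · have : t n * (z n).im = -Real.pi := by
          rw [htn, show (z n).im = -|(z n).im| by rw [h, neg_neg], abs_neg, abs_abs, mul_neg,
            div_mul_cancel₀ _ hpos.ne']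
        rw [this, Complex.ofReal_neg, neg_mul, Complex.exp_neg, Complex.exp_pi_mul_I]
        norm_num
    rw [h5, mul_neg_one]
  let ξ : ℕ → X → ℂ := fun n x => Complex.exp (t n * (γ n x - γ n x₀))
  have hξn : ∀ n x, ‖ξ n x‖ = Real.exp (t n * ((γ n x).re - (γ n x₀).re)) := fun n x => by
    simp only [ξ, Complex.norm_exp, Complex.re_ofReal_mul, Complex.sub_re]
  have hξ2 : ∀ y, g y ≠ 0 → ∀ᶠ n in atTop, ‖ξ n y‖ ≤ 2 := by
    intro y hy
    have h2 : Tendsto (fun n => ‖(γ n y).re - (γ n x₀).re‖) atTop (𝓝 0) := by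
      simpa using ((hre y hy).sub (hre x₀ h0)).norm
    filter_upwards [h2.eventually (gt_mem_nhds (Real.log_pos one_lt_two))] with n hn
    rw [hξn, ← Real.le_log_iff_exp_le two_pos]
    refine le_trans (le_trans (le_abs_self _) ?_) hn.le
    rw [abs_mul, abs_of_nonneg (ht0 n)]
    exact mul_le_of_le_one_left (abs_nonneg _) (ht1 n)
  -- Where `g ≠ 0`, `exp (γ n)` is near `1` on a connected `N`, so `γ n` is nearly constant there,
  -- and so is `ξ n` because `t n ≤ 1`.
  obtain ⟨v, hvc, hvl, hvu⟩ := (hyperfilter ℕ).exists_locallyConstant_limit ξ {y | g y ≠ 0}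
    (fun y hy => by
      obtain ⟨N, hN, hNc, hyN, hNg⟩ := exists_connected_nhds_norm_sub_lt g hy one_half_pos
      refine ⟨N, hN, fun ε hε => ?_⟩
      refine Filter.Eventually.filter_mono hyperfilter_le_atTop ?_
      let κ : ℝ := min (1 / 8) (ε / 24)
      have hκ : 0 < κ := by positivity
      have hκ8 : κ ≤ 1 / 8 := min_le_left _ _
      have hκε : κ ≤ ε / 24 := min_le_right _ _
      have hgy := norm_pos_iff.2 hy
      have hκg : 0 < κ * ‖g y‖ / 8 := by positivity
      filter_upwards [hαu _ hκg, hβu _ hκg, hξ2 y hy] with n ha hb h2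
      have hq : ∀ x ∈ N, ‖Complex.exp (γ n x) - 1‖ ≤ κ := by
        intro x hx
        have ha' := ha x
        have hb' := hb x
        rw [dist_eq_norm] at ha' hb'
        have hx' := hNg x hx
        have hbx : ‖g y‖ / 4 ≤ ‖(β n).cexp x‖ := by
          have i1 := norm_sub_norm_le (g y) (g x)
          have i2 := norm_sub_norm_le (g x) ((β n).cexp x)
          rw [norm_sub_rev] at i1
          nlinarith
        have hbpos : 0 < ‖(β n).cexp x‖ := by linarith
        rw [hexp, div_sub_one (norm_pos_iff.1 hbpos), norm_div, div_le_iff₀ hbpos]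
        have i3 : ‖(α n).cexp x - (β n).cexp x‖ ≤ κ * ‖g y‖ / 8 + κ * ‖g y‖ / 8 := by
          rw [norm_sub_rev] at ha'
          calc _ = ‖((α n).cexp x - g x) + (g x - (β n).cexp x)‖ := by ring_nf
            _ ≤ _ := (norm_add_le _ _).trans (add_le_add ha'.le hb'.le)
        nlinarith
      have hcl := hNc.norm_sub_le_of_norm_exp_sub_one_le (γ := γ n) (η := 4 * κ)
        (by simp only [γ]; fun_prop) hyN (by linarith) (fun x hx => by
          rw [Complex.exp_sub]
          exact norm_div_sub_one_le (hq x hx) (hq y hyN) (by linarith))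
      intro x hx
      have h3 : ξ n x = ξ n y * Complex.exp (t n * (γ n x - γ n y)) := by
        simp only [ξ, ← Complex.exp_add]; congr 1; ring
      have h4 : ‖(t n : ℂ) * (γ n x - γ n y)‖ ≤ 6 * κ := by
        rw [norm_mul, Complex.norm_real, Real.norm_of_nonneg (ht0 n)]
        have := hcl x hx
        exact (mul_le_of_le_one_left (norm_nonneg _) (ht1 n)).trans (by linarith)
      have h5 := Complex.norm_exp_sub_one_le (h4.trans (by linarith))
      rw [h3, ← mul_sub_one, norm_mul]
      calc _ ≤ 2 * (2 * (6 * κ)) := by gcongr; linarith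
        _ ≤ ε := by linarith)
    (fun y hy => ⟨2, (hξ2 y hy).filter_mono hyperfilter_le_atTop⟩)
  have hv0 : v x₀ = 1 := by
    refine tendsto_nhds_unique (hvl x₀ h0) ?_
    simp [ξ]
  have hv1 : v x₁ = -1 :=
    tendsto_nhds_unique (hvl x₁ h1) (htz.mono_left hyperfilter_le_atTop)
  have hv2 : ∀ y, g y ≠ 0 → ‖v y‖ ≤ 2 := fun y hy =>
    le_of_tendsto (hvl y hy).norm ((hξ2 y hy).filter_mono hyperfilter_le_atTop)
  -- Up to a constant factor this is a geometric mean of the two exponentials. Its exponents `t n`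
  -- and `1 - t n` are nonnegative, as membership in `B` requires.
  let h : ℕ → C(X, ℂ) := fun n => ((t n : ℂ) • α n + ((1 - t n : ℝ) : ℂ) • β n
    + ContinuousMap.const X (-(t n * γ n x₀))).cexp
  have hhB : ∀ n, h n ∈ B := fun n =>
    cexp_combination_mem (hα n) (hβ n) (ht0 n) (sub_nonneg.2 (ht1 n)) _
  have hhξ : ∀ n x, h n x = (β n).cexp x * ξ n x := by
    intro n x
    simp only [h, ξ, γ, ContinuousMap.cexp_apply, ContinuousMap.add_apply,
      ContinuousMap.smul_apply, ContinuousMap.const_apply, smul_eq_mul, ← Complex.exp_add]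
    congr 1
    push_cast
    ring
  -- This bound also holds near the zeros of `g`, where `ξ n` is not controlled; it makes `h n`
  -- small there, so the convergence to `g v` is uniform on all of `X`.
  have hhn : ∀ᶠ n in atTop, ∀ x, ‖h n x‖ ≤ max ‖(α n).cexp x‖ ‖(β n).cexp x‖ * 2 := by
    filter_upwards [(hre x₀ h0).norm.eventually
      (gt_mem_nhds (by simpa using Real.log_pos one_lt_two))] with n hn x
    have h2 : ‖h n x‖ = Real.exp (t n * (α n x).re + (1 - t n) * (β n x).re)
        * Real.exp (-(t n * (γ n x₀).re)) := by
      rw [← Real.exp_add]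
      simp [h, Complex.norm_exp]
    rw [h2]
    have h3 : Real.exp (-(t n * (γ n x₀).re)) ≤ 2 := by
      rw [← Real.le_log_iff_exp_le two_pos]
      refine le_trans (neg_le_abs _) (le_trans ?_ hn.le)
      rw [abs_mul, abs_of_nonneg (ht0 n)]
      exact mul_le_of_le_one_left (abs_nonneg _) (ht1 n)
    have h4 : Real.exp (t n * (α n x).re + (1 - t n) * (β n x).re)
        ≤ max ‖(α n).cexp x‖ ‖(β n).cexp x‖ := by
      simp only [ContinuousMap.cexp_apply, Complex.norm_exp]
      rw [← Real.exp_monotone.map_max, Real.exp_le_exp]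
      have i1 := le_max_left (α n x).re (β n x).re
      have i2 := le_max_right (α n x).re (β n x).re
      nlinarith [ht0 n, ht1 n, mul_le_mul_of_nonneg_left i1 (ht0 n),
        mul_le_mul_of_nonneg_left i2 (sub_nonneg.2 (ht1 n))]
    gcongr
  have hunif : TendstoUniformly (fun n x => h n x) (fun x => g x * v x) (hyperfilter ℕ) := by
    rw [Metric.tendstoUniformly_iff]
    intro ε hε
    let δ := ε / 8
    have hδ : 0 < δ := by positivity
    let κ := min 1 (ε / (8 * (4 + ‖g‖)))
    have hgn : 0 ≤ ‖g‖ := norm_nonneg g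
    have hκ : 0 < κ := by positivity
    have hκ1 : κ ≤ 1 := min_le_left _ _
    have hκε : κ * (4 + ‖g‖) ≤ ε / 8 := by
      have : κ ≤ ε / 8 / (4 + ‖g‖) := by
        rw [div_div]; exact min_le_right _ _
      rwa [le_div_iff₀ (by positivity)] at this
    have hK : IsCompact {x | δ ≤ ‖g x‖} :=
      (isClosed_le continuous_const (by fun_prop)).isCompact
    have hKU : {x | δ ≤ ‖g x‖} ⊆ {x | g x ≠ 0} := fun x hx =>
      norm_pos_iff.1 (lt_of_lt_of_le hδ hx)
    filter_upwards [Metric.tendstoUniformlyOn_iff.1 (hvu _ hKU hK) κ hκ,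
      hyperfilter_le_atTop (hαu κ hκ), hyperfilter_le_atTop (hβu κ hκ),
      hyperfilter_le_atTop hhn] with n h2 ha hb h3 x
    have ha' := ha x
    have hb' := hb x
    rw [dist_eq_norm, norm_sub_rev] at ha' hb'
    rw [dist_comm, dist_eq_norm]
    by_cases hx : δ ≤ ‖g x‖
    · have h4 := h2 x hx
      rw [dist_comm, dist_eq_norm] at h4
      have h5 := hv2 x (hKU hx)
      have h6 : ‖ξ n x‖ ≤ 3 := by
        have := norm_add_le (ξ n x - v x) (v x)
        rw [sub_add_cancel] at this
        linarith
      rw [hhξ]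
      have h7 := ContinuousMap.norm_coe_le_norm g x
      calc ‖(β n).cexp x * ξ n x - g x * v x‖
          = ‖((β n).cexp x - g x) * ξ n x + g x * (ξ n x - v x)‖ := by ring_nf
        _ ≤ κ * 3 + ‖g‖ * κ := by
          refine (norm_add_le _ _).trans ?_
          rw [norm_mul, norm_mul]
          gcongr
        _ < ε := by nlinarith
    · push Not at hx
      have h4 : ‖g x * v x‖ ≤ 2 * δ := by
        by_cases hx0 : g x = 0
        · simp [hx0, hδ.le]
        · rw [norm_mul]
          nlinarith [hv2 x hx0, norm_nonneg (g x), norm_nonneg (v x)]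
      have h5 : max ‖(α n).cexp x‖ ‖(β n).cexp x‖ ≤ δ + κ := by
        refine max_le ?_ ?_
        · have := norm_add_le ((α n).cexp x - g x) (g x)
          rw [sub_add_cancel] at this
          linarith
        · have := norm_add_le ((β n).cexp x - g x) (g x)
          rw [sub_add_cancel] at this
          linarith
      have h6 : 4 * κ ≤ ε / 8 := by nlinarith
      calc _ ≤ ‖h n x‖ + ‖g x * v x‖ := norm_sub_le _ _
        _ ≤ (δ + κ) * 2 + 2 * δ := by
          gcongr
          exact (h3 x).trans (by gcongr)
        _ < ε := by simp only [δ]; linarith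
  let G₀ : C(X, ℂ) := ⟨fun x => g x * v x,
    hunif.continuous (Frequently.of_forall fun n => (h n).continuous)⟩
  have hlim : Tendsto h (hyperfilter ℕ) (𝓝 G₀) :=
    ContinuousMap.tendsto_iff_tendstoUniformly.2 hunif
  have hG₀ : G₀ ∈ B := hB.mem_of_tendsto hlim (Eventually.of_forall hhB)
  refine ⟨g + G₀, B.add_mem hgB hG₀, ?_, ?_⟩
  · simp only [G₀, ContinuousMap.add_apply, ContinuousMap.coe_mk, hv0, mul_one, ← two_mul]
    exact mul_ne_zero two_ne_zero h0
  · filter_upwards [hvc x₁ h1] with x hx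
    simp [G₀, hx, hv1]

/-- If exponentials are dense, the logarithmic increments between two points must jump somewhere,
so that `B` contains functions vanishing near one point and not at another. -/
theorem exists_mem_eventually_eq_zero {X : Type*} [TopologicalSpace X] [CompactSpace X]
    [LocallyConnectedSpace X] {B : Subalgebra ℂ C(X, ℂ)} (hB : IsClosed (B : Set C(X, ℂ)))
    (hd : ∀ f ∈ B, f ∈ closure (ContinuousMap.cexp '' expGenerators B)) {f : C(X, ℂ)}
    (hf : f ∈ B) {x₀ x₁ : X} (h0 : f x₀ = 1) (h1 : f x₁ = 0) :
    ∃ G ∈ B, G x₀ ≠ 0 ∧ ∀ᶠ x in 𝓝 x₁, G x = 0 := by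
  by_contra hcon
  let g : ℂ → C(X, ℂ) := fun c => f - ContinuousMap.const X c
  have hgc : Continuous g := by
    have : Continuous fun c : ℂ => ContinuousMap.const X c := ContinuousMap.continuous_const'
    fun_prop
  have hgB : ∀ c, g c ∈ B := fun c => B.sub_mem hf (B.algebraMap_mem c)
  have hg0 : ∀ c, g c x₀ = 1 - c := fun c => by simp [g, h0]
  have hg1 : ∀ c, g c x₁ = -c := fun c => by simp [g, h1]
  have hne0 : ∀ c : ℂ, ‖c‖ = 1 / 2 → 1 - c ≠ 0 := fun c hc h => by
    rw [sub_eq_zero] at h; rw [← h, norm_one] at hc; norm_num at hc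
  have hne1 : ∀ c : ℂ, ‖c‖ = 1 / 2 → -c ≠ 0 := fun c hc h => by
    rw [neg_eq_zero] at h; rw [h, norm_zero] at hc; norm_num at hc
  -- `D α` is a logarithm of the ratio of the values of `exp α` at `x₁` and `x₀`. Without jumps it
  -- converges along `F c` to some `l c`, which would be a continuous logarithm of `-c / (1 - c)` on
  -- the circle.
  let D : C(X, ℂ) → ℂ := fun α => α x₁ - α x₀
  let F : ℂ → Filter C(X, ℂ) := fun c =>
    comap ContinuousMap.cexp (𝓝 (g c)) ⊓ 𝓟 (expGenerators B)
  have hF : ∀ c, (F c).NeBot := by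
    intro c
    rw [inf_neBot_iff]
    rintro s ⟨t, ht, hts⟩ s' hs'
    obtain ⟨_, h2, α, hα, rfl⟩ := mem_closure_iff_nhds.1 (hd _ (hgB c)) t ht
    exact ⟨α, hts h2, hs' hα⟩
  have hFt : ∀ c, Tendsto ContinuousMap.cexp (F c) (𝓝 (g c)) := fun c =>
    tendsto_comap.mono_left inf_le_left
  have hFE : ∀ c, ∀ᶠ α in F c, α ∈ expGenerators B := fun c =>
    mem_inf_of_right (mem_principal_self _)
  have hexpD : ∀ c : ℂ, ‖c‖ = 1 / 2 →
      Tendsto (fun α => Complex.exp (D α)) (F c) (𝓝 (-c / (1 - c))) := by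
    intro c hc
    have e1 := ((continuous_eval_const (F := C(X, ℂ)) x₁).tendsto (g c)).comp (hFt c)
    have e0 := ((continuous_eval_const (F := C(X, ℂ)) x₀).tendsto (g c)).comp (hFt c)
    have := e1.div e0 (by rw [hg0]; exact hne0 c hc)
    rw [hg0, hg1] at this
    refine this.congr fun α => ?_
    simp [D, Complex.exp_sub]
  have hnear : ∀ c : ℂ, ‖c‖ = 1 / 2 → ∀ᶠ p in F c ×ˢ F c, ‖D p.1 - D p.2‖ < 3 := by
    intro c hc
    by_contra hnot
    have hfreq : ∃ᶠ p in F c ×ˢ F c, 3 ≤ ‖D p.1 - D p.2‖ := by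
      simpa only [Filter.Frequently, not_le] using hnot
    have hstep : ∀ n : ℕ, ∃ p : C(X, ℂ) × C(X, ℂ), 3 ≤ ‖D p.1 - D p.2‖ ∧
        (p.1 ∈ expGenerators B ∧ dist p.1.cexp (g c) < 1 / ((n : ℝ) + 1)) ∧
        (p.2 ∈ expGenerators B ∧ dist p.2.cexp (g c) < 1 / ((n : ℝ) + 1)) := by
      intro n
      have h2 : ∀ᶠ α in F c, α ∈ expGenerators B ∧ dist α.cexp (g c) < 1 / ((n : ℝ) + 1) :=
        (hFE c).and ((Metric.tendsto_nhds.1 (hFt c)) _ Nat.one_div_pos_of_nat)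
      exact (hfreq.and_eventually (h2.prod_mk h2)).exists
    choose p hp3 hpα hpβ using hstep
    have hlim := tendsto_one_div_add_atTop_nhds_zero_nat (𝕜 := ℝ)
    refine hcon (exists_mem_eventually_eq_zero_of_jump hB (g := g c)
      (by rw [hg0]; exact hne0 c hc) (by rw [hg1]; exact hne1 c hc)
      (fun n => (hpα n).1) (fun n => (hpβ n).1) ?_ ?_ hp3)
    · exact tendsto_iff_dist_tendsto_zero.2
        (squeeze_zero (fun _ => dist_nonneg) (fun n => (hpα n).2.le) hlim)
    · exact tendsto_iff_dist_tendsto_zero.2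
        (squeeze_zero (fun _ => dist_nonneg) (fun n => (hpβ n).2.le) hlim)
  have hexl : ∀ c : ℂ, ∃ l, ‖c‖ = 1 / 2 → Tendsto D (F c) (𝓝 l) := by
    intro c
    by_cases hc : ‖c‖ = 1 / 2
    swap
    · exact ⟨0, fun h => absurd h hc⟩
    have hw : -c / (1 - c) ≠ 0 := div_ne_zero (hne1 c hc) (hne0 c hc)
    -- The difference has imaginary part below `3 < π`, so it is the principal logarithm of a
    -- quantity tending to `1`.
    have hzero : Tendsto (fun p : C(X, ℂ) × C(X, ℂ) => D p.2 - D p.1) (F c ×ˢ F c) (𝓝 0) := by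
      have e2 := (((hexpD c hc).comp tendsto_snd).div ((hexpD c hc).comp tendsto_fst) hw).clog
        (by rw [div_self hw]; simp)
      rw [div_self hw, Complex.log_one] at e2
      refine e2.congr' ?_
      filter_upwards [hnear c hc] with p hp
      have him := abs_lt.1 ((Complex.abs_im_le_norm _).trans_lt (norm_sub_rev (D p.1) _ ▸ hp))
      simp only [Function.comp_apply, Pi.div_apply]
      rw [← Complex.exp_sub, Complex.log_exp] <;> linarith [Real.pi_gt_three]
    have hcau : Cauchy (map D (F c)) := by
      rw [cauchy_map_iff]
      refine ⟨hF c, ?_⟩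
      rw [uniformity_eq_comap_nhds_zero, tendsto_comap_iff]
      exact hzero
    obtain ⟨l, hl⟩ := CompleteSpace.complete hcau
    exact ⟨l, fun _ => hl⟩
  choose l hl using hexl
  let c : ℝ → ℂ := fun θ => Complex.exp (θ * Complex.I) / 2
  have hcn : ∀ θ, ‖c θ‖ = 1 / 2 := fun θ => by simp [c, Complex.norm_exp_ofReal_mul_I]
  have hcc : Continuous c := by fun_prop
  have hlc : Continuous fun θ => l (c θ) := by
    rw [continuous_iff_continuousAt]
    intro θ₀
    refine Metric.nhds_basis_closedBall.tendsto_right_iff.2 fun ε hε => ?_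
    have h2 := (hl (c θ₀) (hcn θ₀)) (Metric.closedBall_mem_nhds _ hε)
    rw [Filter.mem_map, mem_inf_principal] at h2
    obtain ⟨V, hV, hVs⟩ := h2
    have h3 : ∀ᶠ θ in 𝓝 θ₀, V ∈ 𝓝 (g (c θ)) :=
      (hgc.comp hcc).continuousAt.eventually (eventually_mem_nhds_iff.2 hV)
    filter_upwards [h3] with θ hθ
    have := hF (c θ)
    refine Metric.isClosed_closedBall.mem_of_tendsto (hl (c θ) (hcn θ)) ?_
    filter_upwards [(hFt (c θ)).eventually hθ, hFE (c θ)] with α h4 h5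
    exact hVs h4 h5
  have hlexp : ∀ θ, Complex.exp (l (c θ)) = -c θ / (1 - c θ) := fun θ => by
    have := hF (c θ)
    exact tendsto_nhds_unique (hl _ (hcn θ)).cexp (hexpD _ (hcn θ))
  -- The terms are arranged so that `exp (Λ θ)` is constant. Hence `Λ` is constant, yet over a full
  -- turn only the term `-θ I` changes, by `-2πI`.
  let Λ : ℝ → ℂ := fun θ => l (c θ) + Complex.log (1 - c θ) - θ * Complex.I
  have hΛc : Continuous Λ := by
    have hlog : Continuous fun θ => Complex.log (1 - c θ) := by
      refine Continuous.clog (by fun_prop) fun θ => ?_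
      rw [sub_eq_add_neg]
      refine Complex.mem_slitPlane_of_norm_lt_one ?_
      rw [norm_neg, hcn]; norm_num
    exact (hlc.add hlog).sub (by fun_prop)
  have hΛe : ∀ θ, Complex.exp (Λ θ) = -(1 / 2) := fun θ => by
    simp only [Λ]
    rw [Complex.exp_sub, Complex.exp_add, hlexp, Complex.exp_log (hne0 _ (hcn θ)),
      div_mul_cancel₀ _ (hne0 _ (hcn θ))]
    have := Complex.exp_ne_zero (θ * Complex.I)
    simp only [c]
    field_simp
  have hper := isPreconnected_univ.norm_sub_le_of_norm_exp_sub_one_le (γ := Λ) hΛc.continuousOn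
    (mem_univ 0) (η := 0) (by norm_num) (fun θ _ => by
      rw [Complex.exp_sub, hΛe, hΛe, div_self (by norm_num), sub_self, norm_zero])
    (2 * Real.pi) trivial
  have hc2 : c (2 * Real.pi) = c 0 := by
    simp only [c]
    push_cast
    rw [Complex.exp_two_pi_mul_I]
    simp
  have h9 : Λ (2 * Real.pi) - Λ 0 = 0 := norm_le_zero_iff.1 (by simpa using hper)
  simp only [Λ, hc2] at h9
  push_cast at h9
  have h10 : (2 * Real.pi : ℂ) * Complex.I = 0 := by linear_combination -h9
  exact Complex.two_pi_I_ne_zero h10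

theorem exists_mem_eventually_eq_zero_of_ne {X : Type*} [TopologicalSpace X] [CompactSpace X]
    [LocallyConnectedSpace X] {B : Subalgebra ℂ C(X, ℂ)} (hB : IsClosed (B : Set C(X, ℂ)))
    (hsep : B.SeparatesPoints)
    (hd : ∀ f ∈ B, f ∈ closure (ContinuousMap.cexp '' expGenerators B)) {x₀ x₁ : X}
    (hne : x₀ ≠ x₁) : ∃ G ∈ B, G x₀ ≠ 0 ∧ ∀ᶠ x in 𝓝 x₁, G x = 0 := by
  obtain ⟨_, ⟨f, hf, rfl⟩, hfx⟩ := hsep hne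
  refine exists_mem_eventually_eq_zero hB hd
    (f := (f x₀ - f x₁)⁻¹ • (f - ContinuousMap.const X (f x₁)))
    (B.smul_mem (B.sub_mem hf (B.algebraMap_mem _)) _) ?_ ?_
  · simpa using inv_mul_cancel₀ (sub_ne_zero.2 hfx)
  · simp

/-! ### Bounded pointwise closure and its indicator functions. -/

/-- The smallest class of functions containing a set of continuous functions and closed under
bounded pointwise limits of sequences. -/
inductive BoundedPointwiseClosure {X : Type*} [TopologicalSpace X] (B : Set C(X, ℂ)) :
    (X → ℂ) → Prop
  | of (b : C(X, ℂ)) (hb : b ∈ B) : BoundedPointwiseClosure B b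
  | lim (h : ℕ → X → ℂ) (k : X → ℂ) (C : ℝ) (hh : ∀ n, BoundedPointwiseClosure B (h n))
      (hC : ∀ n x, ‖h n x‖ ≤ C) (hk : ∀ x, Tendsto (fun n => h n x) atTop (𝓝 (k x))) :
      BoundedPointwiseClosure B k

namespace BoundedPointwiseClosure

variable {X : Type*} [TopologicalSpace X] [CompactSpace X] {B : Subalgebra ℂ C(X, ℂ)}
  {h k : X → ℂ}

theorem exists_bound {B : Set C(X, ℂ)} (hh : BoundedPointwiseClosure B h) :
    ∃ C, ∀ x, ‖h x‖ ≤ C := by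
  induction hh with
  | of b _ => exact ⟨‖b‖, b.norm_coe_le_norm⟩
  | lim h k C _ hC hk _ =>
    exact ⟨C, fun x => le_of_tendsto (hk x).norm (Eventually.of_forall fun n => hC n x)⟩

/-- Two successive inductions, each with the other argument fixed: continuity passes to pointwise
limits and bounded sets have bounded image. This serves sums and products alike. -/
theorem op (f : ℂ → ℂ → ℂ) (hf : Continuous fun p : ℂ × ℂ => f p.1 p.2)
    (hop : ∀ a ∈ B, ∀ b ∈ B, BoundedPointwiseClosure (B : Set C(X, ℂ)) fun x => f (a x) (b x))
    (hh : BoundedPointwiseClosure (B : Set C(X, ℂ)) h)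
    (hk : BoundedPointwiseClosure (B : Set C(X, ℂ)) k) :
    BoundedPointwiseClosure (B : Set C(X, ℂ)) fun x => f (h x) (k x) := by
  have hbd : ∀ C C' : ℝ, ∃ M, ∀ z w, ‖z‖ ≤ C → ‖w‖ ≤ C' → ‖f z w‖ ≤ M := by
    intro C C'
    obtain ⟨M, hM⟩ := (((isCompact_closedBall (0 : ℂ) C).prod
      (isCompact_closedBall (0 : ℂ) C')).image hf).isBounded.exists_norm_le
    exact ⟨M, fun z w hz hw => hM _ ⟨(z, w), ⟨by simpa using hz, by simpa using hw⟩, rfl⟩⟩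
  have step : ∀ a ∈ B, ∀ k, BoundedPointwiseClosure (B : Set C(X, ℂ)) k →
      BoundedPointwiseClosure (B : Set C(X, ℂ)) fun x => f (a x) (k x) := by
    intro a ha k hk
    induction hk with
    | of b hb => exact hop a ha b hb
    | lim h k C _ hC hk ih =>
      obtain ⟨M, hM⟩ := hbd ‖a‖ C
      exact lim (fun n x => f (a x) (h n x)) _ M ih
        (fun n x => hM _ _ (a.norm_coe_le_norm x) (hC n x))
        fun x => (hf.tendsto (a x, k x)).comp (tendsto_const_nhds.prodMk_nhds (hk x))
  obtain ⟨C', hC'⟩ := hk.exists_bound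
  induction hh with
  | of a ha => exact step a ha k hk
  | lim h h' C _ hC hlim ih =>
    obtain ⟨M, hM⟩ := hbd C C'
    exact lim (fun n x => f (h n x) (k x)) _ M ih (fun n x => hM _ _ (hC n x) (hC' x))
      fun x => (hf.tendsto (h' x, k x)).comp ((hlim x).prodMk_nhds tendsto_const_nhds)

theorem mul (hh : BoundedPointwiseClosure (B : Set C(X, ℂ)) h)
    (hk : BoundedPointwiseClosure (B : Set C(X, ℂ)) k) :
    BoundedPointwiseClosure (B : Set C(X, ℂ)) fun x => h x * k x :=
  op (· * ·) (by fun_prop) (fun a ha b hb => of (a * b) (B.mul_mem ha hb)) hh hk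

theorem add (hh : BoundedPointwiseClosure (B : Set C(X, ℂ)) h)
    (hk : BoundedPointwiseClosure (B : Set C(X, ℂ)) k) :
    BoundedPointwiseClosure (B : Set C(X, ℂ)) fun x => h x + k x :=
  op (· + ·) (by fun_prop) (fun a ha b hb => of (a + b) (B.add_mem ha hb)) hh hk

omit [CompactSpace X] in
theorem const (c : ℂ) : BoundedPointwiseClosure (B : Set C(X, ℂ)) fun _ => c :=
  of (ContinuousMap.const X c) (B.algebraMap_mem c)

theorem sum {ι : Type*} (s : Finset ι) {h : ι → X → ℂ}
    (hh : ∀ i ∈ s, BoundedPointwiseClosure (B : Set C(X, ℂ)) (h i)) :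
    BoundedPointwiseClosure (B : Set C(X, ℂ)) fun x => ∑ i ∈ s, h i x := by
  classical
  induction s using Finset.induction_on with
  | empty => simpa using const 0
  | insert i s hi ih =>
    simp only [Finset.sum_insert hi]
    exact (hh i (Finset.mem_insert_self _ _)).add
      (ih fun j hj => hh j (Finset.mem_insert_of_mem hj))

theorem pow (hh : BoundedPointwiseClosure (B : Set C(X, ℂ)) h) (n : ℕ) :
    BoundedPointwiseClosure (B : Set C(X, ℂ)) fun x => h x ^ n := by
  induction n with
  | zero => simpa using const 1
  | succ n ih => simpa only [pow_succ] using ih.mul hh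

/-- Cesàro means of the powers of a contraction converge to an indicator function. -/
theorem indicator_eq_one (hh : BoundedPointwiseClosure (B : Set C(X, ℂ)) h)
    (h1 : ∀ x, ‖h x‖ ≤ 1) :
    BoundedPointwiseClosure (B : Set C(X, ℂ)) ({x | h x = 1}.indicator 1) := by
  refine lim (fun n x => ((n : ℂ) + 1)⁻¹ * ∑ i ∈ Finset.range (n + 1), h x ^ i) _ 1
    (fun n => (const _).mul (sum _ fun i _ => hh.pow i)) (fun n x => ?_) fun x => ?_
  · have hn : ‖(n : ℂ) + 1‖ = n + 1 := by
      rw [← Nat.cast_add_one, Complex.norm_natCast]; push_cast; rfl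
    rw [norm_mul, norm_inv, hn, inv_mul_le_iff₀ (by positivity), mul_one]
    refine (norm_sum_le _ _).trans ?_
    refine (Finset.sum_le_sum fun i _ => (?_ : ‖h x ^ i‖ ≤ 1)).trans (by simp)
    rw [norm_pow]; exact pow_le_one₀ (norm_nonneg _) (h1 x)
  · by_cases hx : h x = 1
    · have hn : ∀ n : ℕ, (n : ℂ) + 1 ≠ 0 := fun n => by exact_mod_cast n.succ_ne_zero
      simp [hx, hn]
    · rw [indicator_of_notMem (by exact hx)]
      have hlim : Tendsto (fun n : ℕ => 1 / ((n : ℝ) + 1) * (2 / ‖h x - 1‖)) atTop (𝓝 0) := by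
        simpa using (tendsto_one_div_add_atTop_nhds_zero_nat (𝕜 := ℝ)).mul_const (2 / ‖h x - 1‖)
      refine squeeze_zero_norm (fun n => ?_) hlim
      have hn : ‖(n : ℂ) + 1‖ = n + 1 := by
        rw [← Nat.cast_add_one, Complex.norm_natCast]; push_cast; rfl
      rw [geom_sum_eq hx, norm_mul, norm_inv, hn, one_div, norm_div]
      gcongr
      refine (norm_sub_le _ _).trans ?_
      rw [norm_one, norm_pow]
      linarith [pow_le_one₀ (norm_nonneg _) (h1 x) (n := n + 1)]

end BoundedPointwiseClosure

/-! ### Unimodular limits of small powers. -/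

/-- Let `exp (α n)` approximate `G` within `exp (-(n + 1) ^ 2)` and raise it to the power `1 / (n +
1)`. Where `G ≠ 0` the moduli tend to `1` and local variation dies out; where `G = 0` they are at
most `exp (-(n + 1))`. The set `{h = 1}` then separates a neighbourhood of `x₀` from the zeros of
`G`. -/
theorem exists_boundedPointwiseClosure_eq_one {X : Type*} [TopologicalSpace X] [CompactSpace X]
    [LocallyConnectedSpace X] {B : Subalgebra ℂ C(X, ℂ)}
    (hd : ∀ f ∈ B, f ∈ closure (ContinuousMap.cexp '' expGenerators B)) {G : C(X, ℂ)}
    (hG : G ∈ B) {x₀ : X} (h0 : G x₀ ≠ 0) :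
    ∃ h, BoundedPointwiseClosure (B : Set C(X, ℂ)) h ∧ (∀ x, ‖h x‖ ≤ 1) ∧
      (∀ᶠ x in 𝓝 x₀, h x = 1) ∧ ∀ x, G x = 0 → h x = 0 := by
  have hα : ∀ n : ℕ, ∃ α ∈ expGenerators B, ‖α.cexp - G‖ < Real.exp (-((n : ℝ) + 1) ^ 2) := by
    intro n
    obtain ⟨_, ⟨α, hα, rfl⟩, h⟩ := Metric.mem_closure_iff.1 (hd G hG) _
      (Real.exp_pos (-((n : ℝ) + 1) ^ 2))
    exact ⟨α, hα, by rwa [dist_comm, dist_eq_norm] at h⟩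
  choose α hαE hαG using hα
  have hαx : ∀ n x, ‖(α n).cexp x - G x‖ < Real.exp (-((n : ℝ) + 1) ^ 2) := fun n x =>
    ((α n).cexp - G).norm_coe_le_norm x |>.trans_lt (hαG n)
  have hε0 : Tendsto (fun n : ℕ => Real.exp (-((n : ℝ) + 1) ^ 2)) atTop (𝓝 0) := by
    have h1 : Tendsto (fun n : ℕ => ((n : ℝ) + 1) ^ 2) atTop atTop :=
      (tendsto_pow_atTop two_ne_zero).comp
        (tendsto_atTop_add_const_right _ 1 tendsto_natCast_atTop_atTop)
    exact Real.tendsto_exp_neg_atTop_nhds_zero.comp h1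
  have hs0 := tendsto_one_div_add_atTop_nhds_zero_nat (𝕜 := ℝ)
  let s : ℕ → ℝ := fun n => 1 / ((n : ℝ) + 1)
  have hspos : ∀ n, 0 < s n := fun n => Nat.one_div_pos_of_nat
  have hs1 : ∀ n, s n ≤ 1 := fun n => by
    rw [div_le_one (by positivity)]; linarith [n.cast_nonneg (α := ℝ)]
  have hre : ∀ y, G y ≠ 0 → Tendsto (fun n => s n * (α n y).re) atTop (𝓝 0) := by
    intro y hy
    have h1 : Tendsto (fun n => (α n).cexp y) atTop (𝓝 (G y)) := by
      rw [tendsto_iff_norm_sub_tendsto_zero]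
      exact squeeze_zero (fun _ => norm_nonneg _) (fun n => (hαx n y).le) hε0
    have h2 := h1.norm.log (norm_ne_zero_iff.2 hy)
    simp only [ContinuousMap.cexp_apply, Complex.norm_exp, Real.log_exp] at h2
    have h3 := hs0.mul h2
    rwa [zero_mul] at h3
  let ξ : ℕ → X → ℂ := fun n x => Complex.exp (s n * (α n x - α n x₀))
  have hξn : ∀ n x, ‖ξ n x‖ = Real.exp (s n * (α n x).re - s n * (α n x₀).re) := fun n x => by
    simp only [ξ, Complex.norm_exp, Complex.re_ofReal_mul, Complex.sub_re, mul_sub]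
  have hξ1 : ∀ y, G y ≠ 0 → Tendsto (fun n => ‖ξ n y‖) atTop (𝓝 1) := by
    intro y hy
    simp only [hξn]
    have := (Real.continuous_exp.tendsto _).comp ((hre y hy).sub (hre x₀ h0))
    rwa [sub_zero, Real.exp_zero] at this
  have hξ2 : ∀ y, G y ≠ 0 → ∀ᶠ n in atTop, ‖ξ n y‖ ≤ 2 := fun y hy =>
    (hξ1 y hy).eventually (ge_mem_nhds one_lt_two)
  obtain ⟨v, hvc, hvl, hvu⟩ := (hyperfilter ℕ).exists_locallyConstant_limit ξ {y | G y ≠ 0}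
    (fun y hy => by
      obtain ⟨N, hN, hNc, hyN, hNg⟩ :=
        exists_connected_nhds_norm_sub_lt G hy (δ := 1 / 8) (by norm_num)
      refine ⟨N, hN, fun ε hε => ?_⟩
      refine Filter.Eventually.filter_mono hyperfilter_le_atTop ?_
      have hgy := norm_pos_iff.2 hy
      filter_upwards [hε0.eventually (gt_mem_nhds (by positivity : 0 < ‖G y‖ / 8)), hξ2 y hy,
        hs0.eventually (gt_mem_nhds (by positivity : 0 < ε / 3))] with n hn h2 h3
      have hcl := hNc.norm_sub_le_of_norm_exp_sub_one_le (γ := α n) (η := 1 / 2)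
        (by fun_prop) hyN le_rfl (fun x hx => by
          have ha := hαx n x
          have hb := hαx n y
          have hx' := hNg x hx
          have hby : ‖G y‖ * (7 / 8) ≤ ‖(α n).cexp y‖ := by
            have i1 := norm_sub_norm_le (G y) ((α n).cexp y)
            rw [norm_sub_rev] at i1
            linarith
          have hbpos : 0 < ‖(α n).cexp y‖ := by linarith
          rw [Complex.exp_sub, ← ContinuousMap.cexp_apply, ← ContinuousMap.cexp_apply,
            div_sub_one (norm_pos_iff.1 hbpos), norm_div, div_le_iff₀ hbpos]
          have i2 : ‖(α n).cexp x - (α n).cexp y‖ ≤ ‖G y‖ / 8 + 1 / 8 * ‖G y‖ + ‖G y‖ / 8 := by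
            calc _ = ‖((α n).cexp x - G x) + (G x - G y) - ((α n).cexp y - G y)‖ := by ring_nf
              _ ≤ _ := (norm_sub_le _ _).trans (add_le_add ((norm_add_le _ _).trans
                (add_le_add (ha.trans hn).le hx'.le)) (hb.trans hn).le)
          linarith)
      intro x hx
      have h4 : ξ n x = ξ n y * Complex.exp (s n * (α n x - α n y)) := by
        simp only [ξ, ← Complex.exp_add]; congr 1; ring
      have h5 : ‖(s n : ℂ) * (α n x - α n y)‖ ≤ s n * (3 / 4) := by
        rw [norm_mul, Complex.norm_real, Real.norm_of_nonneg (hspos n).le]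
        gcongr
        exact (hcl x hx).trans (by norm_num)
      have h6 := Complex.norm_exp_sub_one_le (h5.trans (by linarith [hs1 n]))
      rw [h4, ← mul_sub_one, norm_mul]
      have h7 : s n < ε / 3 := h3
      calc _ ≤ 2 * (2 * (s n * (3 / 4))) := by gcongr; linarith
        _ ≤ ε := by linarith)
    (fun y hy => ⟨2, (hξ2 y hy).filter_mono hyperfilter_le_atTop⟩)
  have hv0 : v x₀ = 1 := by
    refine tendsto_nhds_unique (hvl x₀ h0) ?_
    simp [ξ]
  have hv1 : ∀ y, G y ≠ 0 → ‖v y‖ = 1 := fun y hy =>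
    tendsto_nhds_unique (hvl y hy).norm ((hξ1 y hy).mono_left hyperfilter_le_atTop)
  let M : ℝ := Real.log (‖G‖ + 1)
  have hM0 : 0 ≤ M := Real.log_nonneg (by linarith [norm_nonneg G])
  have hx0n : ∀ᶠ n in atTop, ‖s n * (α n x₀).re‖ < 1 :=
    (tendsto_zero_iff_norm_tendsto_zero.1 (hre x₀ h0)).eventually (gt_mem_nhds one_pos)
  have hbound : ∀ᶠ n in atTop, ∀ x, ‖ξ n x‖ ≤ Real.exp (M + 1) := by
    filter_upwards [hx0n] with n hn x
    rw [hξn, Real.exp_le_exp]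
    have h1 : (α n x).re ≤ M := by
      rw [Real.le_log_iff_exp_le (by positivity), ← Complex.norm_exp, ← ContinuousMap.cexp_apply]
      have i1 := norm_sub_norm_le ((α n).cexp x) (G x)
      have i2 := hαx n x
      have i3 := G.norm_coe_le_norm x
      have i4 : Real.exp (-((n : ℝ) + 1) ^ 2) ≤ 1 := Real.exp_le_one_iff.2 (by nlinarith)
      linarith
    have h2 : s n * (α n x).re ≤ M := by nlinarith [hspos n, hs1 n]
    have h3 := (abs_lt.1 hn).1
    linarith
  have hzero : ∀ ε > 0, ∀ᶠ n in atTop, ∀ x, G x = 0 → ‖ξ n x‖ < ε := by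
    intro ε hε
    have hlim : Tendsto (fun n : ℕ => Real.exp (-(n : ℝ))) atTop (𝓝 0) :=
      Real.tendsto_exp_neg_atTop_nhds_zero.comp tendsto_natCast_atTop_atTop
    filter_upwards [hx0n, hlim.eventually (gt_mem_nhds hε)] with n hn h1 x hx
    refine lt_of_le_of_lt ?_ h1
    rw [hξn, Real.exp_le_exp]
    have h2 := hαx n x
    rw [hx, sub_zero, ContinuousMap.cexp_apply, Complex.norm_exp, Real.exp_lt_exp] at h2
    have h3 : s n * (α n x).re ≤ s n * (-((n : ℝ) + 1) ^ 2) :=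
      mul_le_mul_of_nonneg_left h2.le (hspos n).le
    have h4 : s n * (-((n : ℝ) + 1) ^ 2) = -((n : ℝ) + 1) := by
      have : (n : ℝ) + 1 ≠ 0 := by positivity
      simp only [s]; field_simp
    have h5 := (abs_lt.1 hn).1
    linarith
  -- The convergence is only along an ultrafilter, whereas the closure needs sequences. Uniformity
  -- on the compact sets `{1 / (k + 1) ≤ ‖G‖}`, which exhaust `{G ≠ 0}`, allows one index to be
  -- chosen for each `k`.
  have hpick : ∀ k : ℕ, ∃ n, (∀ x ∈ {x | 1 / ((k : ℝ) + 1) ≤ ‖G x‖},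
      dist (v x) (ξ n x) < 1 / ((k : ℝ) + 1)) ∧ (∀ x, G x = 0 → ‖ξ n x‖ < 1 / ((k : ℝ) + 1)) ∧
      ∀ x, ‖ξ n x‖ ≤ Real.exp (M + 1) := by
    intro k
    have hk : 0 < 1 / ((k : ℝ) + 1) := Nat.one_div_pos_of_nat
    have hK : IsCompact {x | 1 / ((k : ℝ) + 1) ≤ ‖G x‖} :=
      (isClosed_le continuous_const (by fun_prop)).isCompact
    have hKU : {x | 1 / ((k : ℝ) + 1) ≤ ‖G x‖} ⊆ {x | G x ≠ 0} := fun x hx =>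
      norm_pos_iff.1 (lt_of_lt_of_le hk hx)
    exact ((Metric.tendstoUniformlyOn_iff.1 (hvu _ hKU hK) _ hk).and
      (((hzero _ hk).filter_mono hyperfilter_le_atTop).and
        (hbound.filter_mono hyperfilter_le_atTop))).exists
  choose n hn1 hn2 hn3 using hpick
  classical
  refine ⟨fun x => if G x = 0 then 0 else v x, .lim (fun k => ξ (n k)) _ (Real.exp (M + 1))
    (fun k => ?_) (fun k x => hn3 k x) (fun x => ?_), fun x => ?_, ?_, fun x hx => if_pos hx⟩
  · have := cexp_combination_mem (hαE (n k)) (hαE (n k)) (hspos (n k)).le le_rfl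
      (-(s (n k) * α (n k) x₀))
    convert BoundedPointwiseClosure.of _ this using 1
    ext x
    simp [ξ, mul_add, sub_eq_add_neg]
  · by_cases hx : G x = 0
    · rw [if_pos hx]
      exact squeeze_zero_norm (fun k => (hn2 k x hx).le) hs0
    · rw [if_neg hx, tendsto_iff_dist_tendsto_zero]
      refine squeeze_zero' (Eventually.of_forall fun _ => dist_nonneg) ?_ hs0
      filter_upwards [hs0.eventually (ge_mem_nhds (norm_pos_iff.2 hx))] with k hk
      rw [dist_comm]
      exact (hn1 k x hk).le
  · by_cases hx : G x = 0
    · simp [hx]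
    · simp only [if_neg hx, hv1 x hx, le_refl]
  · have hne : ∀ᶠ x in 𝓝 x₀, G x ≠ 0 := G.continuous.continuousAt.eventually_ne h0
    filter_upwards [hne, hvc x₀ h0] with x h1 h2
    rw [if_neg h1, h2, hv0]

/-! ### From separating indicators to continuous functions and mean approximation. -/

namespace BoundedPointwiseClosure

variable {X : Type*} [TopologicalSpace X] [CompactSpace X] {B : Subalgebra ℂ C(X, ℂ)}

theorem indicator_inter {S T : Set X}
    (hS : BoundedPointwiseClosure (B : Set C(X, ℂ)) (S.indicator 1))
    (hT : BoundedPointwiseClosure (B : Set C(X, ℂ)) (T.indicator 1)) :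
    BoundedPointwiseClosure (B : Set C(X, ℂ)) ((S ∩ T).indicator 1) := by
  have := hS.mul hT
  rwa [inter_indicator_one]

theorem indicator_compl {S : Set X}
    (hS : BoundedPointwiseClosure (B : Set C(X, ℂ)) (S.indicator 1)) :
    BoundedPointwiseClosure (B : Set C(X, ℂ)) (Sᶜ.indicator 1) := by
  have := (const (B := B) 1).add ((const (B := B) (-1)).mul hS)
  convert this using 1
  ext x
  by_cases hx : x ∈ S <;> simp [hx]

/-- The sets with admissible indicator form a Boolean algebra, so compactness of `L`, then of `K`,
upgrades separation of points. -/
theorem exists_indicator_separating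
    (hpt : ∀ x y : X, x ≠ y → ∃ S : Set X,
      BoundedPointwiseClosure (B : Set C(X, ℂ)) (S.indicator 1) ∧ S ∈ 𝓝 x ∧ Sᶜ ∈ 𝓝 y)
    {K L : Set X} (hK : IsCompact K) (hL : IsCompact L) (hKL : Disjoint K L) :
    ∃ S : Set X, BoundedPointwiseClosure (B : Set C(X, ℂ)) (S.indicator 1) ∧ K ⊆ S ∧
      L ⊆ Sᶜ := by
  have hpL : ∀ x ∉ L, ∃ S : Set X, BoundedPointwiseClosure (B : Set C(X, ℂ)) (S.indicator 1) ∧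
      S ∈ 𝓝 x ∧ L ⊆ Sᶜ := by
    intro x hx
    refine hL.induction_on (p := fun t => ∃ S : Set X,
      BoundedPointwiseClosure (B : Set C(X, ℂ)) (S.indicator 1) ∧ S ∈ 𝓝 x ∧ t ⊆ Sᶜ)
      ⟨univ, by rw [indicator_univ]; exact const 1, univ_mem, empty_subset _⟩ ?_ ?_ ?_
    · rintro s t hst ⟨S, h1, h2, h3⟩
      exact ⟨S, h1, h2, hst.trans h3⟩
    · rintro s t ⟨S, h1, h2, h3⟩ ⟨T, h4, h5, h6⟩
      refine ⟨S ∩ T, h1.indicator_inter h4, inter_mem h2 h5, ?_⟩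
      rw [compl_inter]
      exact union_subset_union h3 h6
    · intro y hy
      obtain ⟨S, h1, h2, h3⟩ := hpt x y fun h => hx (h ▸ hy)
      exact ⟨Sᶜ, mem_nhdsWithin_of_mem_nhds h3, S, h1, h2, Subset.rfl⟩
  refine hK.induction_on (p := fun t => ∃ S : Set X,
    BoundedPointwiseClosure (B : Set C(X, ℂ)) (S.indicator 1) ∧ t ⊆ S ∧ L ⊆ Sᶜ)
    ⟨∅, by simpa using const 0, Subset.rfl, by simp⟩ ?_ ?_ ?_
  · rintro s t hst ⟨S, h1, h2, h3⟩
    exact ⟨S, h1, hst.trans h2, h3⟩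
  · rintro s t ⟨S, h1, h2, h3⟩ ⟨T, h4, h5, h6⟩
    refine ⟨S ∪ T, ?_, union_subset_union h2 h5, by rw [compl_union]; exact subset_inter h3 h6⟩
    have := (h1.indicator_compl.indicator_inter h4.indicator_compl).indicator_compl
    rwa [← compl_union, compl_compl] at this
  · intro x hx
    obtain ⟨S, h1, h2, h3⟩ := hpL x (hKL.notMem_of_mem_left hx)
    exact ⟨S, mem_nhdsWithin_of_mem_nhds h2, S, h1, Subset.rfl, h3⟩

/-- With `S n j` separating `{(n + 1) φ ≥ j + 1}` from `{(n + 1) φ ≤ j}`, the number of `j ≤ n` with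
`x ∈ S n j` is within `1` of `(n + 1) φ x`; dividing by `n + 1` gives uniform approximation. -/
theorem of_continuous_unitInterval
    (hpt : ∀ x y : X, x ≠ y → ∃ S : Set X,
      BoundedPointwiseClosure (B : Set C(X, ℂ)) (S.indicator 1) ∧ S ∈ 𝓝 x ∧ Sᶜ ∈ 𝓝 y)
    {φ : X → ℝ} (hφ : Continuous φ) (h0 : ∀ x, 0 ≤ φ x) (h1 : ∀ x, φ x ≤ 1) :
    BoundedPointwiseClosure (B : Set C(X, ℂ)) fun x => (φ x : ℂ) := by
  classical
  have hS : ∀ n j : ℕ, ∃ S : Set X, BoundedPointwiseClosure (B : Set C(X, ℂ)) (S.indicator 1) ∧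
      {x | (j : ℝ) + 1 ≤ ((n : ℝ) + 1) * φ x} ⊆ S ∧
      {x | ((n : ℝ) + 1) * φ x ≤ j} ⊆ Sᶜ := by
    intro n j
    refine exists_indicator_separating hpt
      (isClosed_le (by fun_prop) (by fun_prop)).isCompact
      (isClosed_le (by fun_prop) (by fun_prop)).isCompact ?_
    rw [Set.disjoint_left]
    intro x (hx : (j : ℝ) + 1 ≤ _) (hx' : _ ≤ (j : ℝ))
    linarith
  choose S hSB hS1 hS2 using hS
  have hcount : ∀ n x, ∃ m : ℕ, (∑ j ∈ Finset.range (n + 1), (S n j).indicator (1 : X → ℂ) x) = m ∧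
      |(m : ℝ) - ((n : ℝ) + 1) * φ x| ≤ 1 := by
    intro n x
    refine ⟨((Finset.range (n + 1)).filter fun j => x ∈ S n j).card, ?_, ?_⟩
    · rw [Finset.card_filter]
      push_cast
      exact Finset.sum_congr rfl fun j _ => by simp [indicator_apply]
    · have hnn : 0 ≤ ((n : ℝ) + 1) * φ x := mul_nonneg (by positivity) (h0 x)
      have i1 := Nat.floor_le hnn
      have i2 := Nat.lt_floor_add_one (((n : ℝ) + 1) * φ x)
      set f := ⌊((n : ℝ) + 1) * φ x⌋₊
      have hfn : f ≤ n + 1 := by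
        have : (f : ℝ) ≤ n + 1 := by nlinarith [h1 x]
        exact_mod_cast this
      have l1 : f ≤ ((Finset.range (n + 1)).filter fun j => x ∈ S n j).card := by
        conv_lhs => rw [← Finset.card_range f]
        refine Finset.card_le_card fun j hj => ?_
        rw [Finset.mem_range] at hj
        refine Finset.mem_filter.2 ⟨Finset.mem_range.2 (by omega), hS1 n j ?_⟩
        have : (j : ℝ) + 1 ≤ f := by exact_mod_cast hj
        exact this.trans i1
      have l2 : ((Finset.range (n + 1)).filter fun j => x ∈ S n j).card ≤ f + 1 := by
        conv_rhs => rw [← Finset.card_range (f + 1)]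
        refine Finset.card_le_card fun j hj => ?_
        have hj' := (Finset.mem_filter.1 hj).2
        rw [Finset.mem_range]
        by_contra! hlt
        have : (f : ℝ) + 1 ≤ j := by exact_mod_cast hlt
        exact hS2 n j (i2.le.trans this) hj'
      have l1' : (f : ℝ) ≤ _ := Nat.cast_le.2 l1
      have l2' := (Nat.cast_le (α := ℝ)).2 l2
      push_cast at l2'
      rw [abs_le]
      constructor <;> linarith
  have hn : ∀ n : ℕ, ‖(n : ℂ) + 1‖ = n + 1 := fun n => by
    rw [← Nat.cast_add_one, Complex.norm_natCast]; push_cast; rfl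
  have hdiff : ∀ (n : ℕ) x, ‖((n : ℂ) + 1)⁻¹ * ∑ j ∈ Finset.range (n + 1),
      (S n j).indicator (1 : X → ℂ) x - φ x‖ ≤ 1 / ((n : ℝ) + 1) := by
    intro n x
    obtain ⟨m, hm, hm'⟩ := hcount n x
    have hne : (n : ℂ) + 1 ≠ 0 := norm_pos_iff.1 (by rw [hn]; positivity)
    rw [hm, show ((n : ℂ) + 1)⁻¹ * m - φ x
      = ((n : ℂ) + 1)⁻¹ * (((m : ℝ) - ((n : ℝ) + 1) * φ x : ℝ) : ℂ) by
        push_cast; field_simp, norm_mul, norm_inv, hn, Complex.norm_real, one_div]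
    exact mul_le_of_le_one_right (by positivity) hm'
  refine lim (fun n x => ((n : ℂ) + 1)⁻¹ * ∑ j ∈ Finset.range (n + 1),
    (S n j).indicator (1 : X → ℂ) x) _ 2
    (fun n => (const _).mul (sum _ fun j _ => hSB n j)) (fun n x => ?_) fun x => ?_
  · have i1 := hdiff n x
    have i2 := norm_sub_norm_le (((n : ℂ) + 1)⁻¹ * ∑ j ∈ Finset.range (n + 1),
      (S n j).indicator (1 : X → ℂ) x) (φ x : ℂ)
    have i3 : ‖(φ x : ℂ)‖ ≤ 1 := by
      rw [Complex.norm_real, Real.norm_of_nonneg (h0 x)]; exact h1 x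
    have i4 : 1 / ((n : ℝ) + 1) ≤ 1 := by
      rw [div_le_one (by positivity)]; linarith [n.cast_nonneg (α := ℝ)]
    linarith
  · rw [tendsto_iff_norm_sub_tendsto_zero]
    exact squeeze_zero (fun _ => norm_nonneg _) (fun n => hdiff n x)
      (tendsto_one_div_add_atTop_nhds_zero_nat (𝕜 := ℝ))

theorem of_continuous
    (hpt : ∀ x y : X, x ≠ y → ∃ S : Set X,
      BoundedPointwiseClosure (B : Set C(X, ℂ)) (S.indicator 1) ∧ S ∈ 𝓝 x ∧ Sᶜ ∈ 𝓝 y)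
    (φ : C(X, ℂ)) : BoundedPointwiseClosure (B : Set C(X, ℂ)) φ := by
  let M : ℝ := ‖φ‖ + 1
  have hM : 0 < M := by positivity
  have key : ∀ ψ : X → ℝ, Continuous ψ → (∀ x, |ψ x| ≤ M) →
      BoundedPointwiseClosure (B : Set C(X, ℂ)) fun x => (ψ x : ℂ) := by
    intro ψ hψ hb
    have h1 := of_continuous_unitInterval hpt (φ := fun x => (ψ x + M) / (2 * M)) (by fun_prop)
      (fun x => div_nonneg (by linarith [(abs_le.1 (hb x)).1]) (by positivity))
      (fun x => by
        rw [div_le_one (by positivity)]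
        linarith [(abs_le.1 (hb x)).2])
    convert ((const (B := B) ((2 * M : ℝ) : ℂ)).mul h1).add (const (B := B) ((-M : ℝ) : ℂ)) using 2
    have : (M : ℂ) ≠ 0 := by exact_mod_cast hM.ne'
    push_cast
    field_simp
    ring
  have hle : ∀ x, ‖φ x‖ ≤ M := fun x => (φ.norm_coe_le_norm x).trans (by simp [M])
  have h1 := key (fun x => (φ x).re) (by fun_prop)
    fun x => (Complex.abs_re_le_norm _).trans (hle x)
  have h2 := key (fun x => (φ x).im) (by fun_prop)
    fun x => (Complex.abs_im_le_norm _).trans (hle x)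
  convert h1.add (h2.mul (const Complex.I)) using 2
  rw [Complex.re_add_im]

variable [MeasurableSpace X] [BorelSpace X]

omit [CompactSpace X] in
theorem aestronglyMeasurable {h : X → ℂ} (hh : BoundedPointwiseClosure (B : Set C(X, ℂ)) h)
    (ν : Measure X) : AEStronglyMeasurable h ν := by
  induction hh with
  | of b _ => exact b.continuous.aestronglyMeasurable
  | lim h k C _ _ hk ih =>
    exact aestronglyMeasurable_of_tendsto_ae atTop ih (Eventually.of_forall hk)

theorem integrable {h : X → ℂ} (hh : BoundedPointwiseClosure (B : Set C(X, ℂ)) h)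
    (ν : Measure X) [IsFiniteMeasure ν] : Integrable h ν := by
  obtain ⟨C, hC⟩ := hh.exists_bound
  exact Integrable.of_bound (hh.aestronglyMeasurable ν) C (Eventually.of_forall hC)

/-- Dominated convergence at each limit stage keeps the class inside the `L¹(ν)`-closure of `B`. -/
theorem exists_integral_norm_sub_lt {h : X → ℂ}
    (hh : BoundedPointwiseClosure (B : Set C(X, ℂ)) h) (ν : Measure X) [IsFiniteMeasure ν]
    {ε : ℝ} (hε : 0 < ε) : ∃ b ∈ B, ∫ x, ‖h x - b x‖ ∂ν < ε := by
  induction hh generalizing ε with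
  | of b hb => exact ⟨b, hb, by simpa using hε⟩
  | lim h k C hh hC hk ih =>
    have hkB : BoundedPointwiseClosure (B : Set C(X, ℂ)) k := lim h k C hh hC hk
    have hlim : Tendsto (fun n => ∫ x, ‖k x - h n x‖ ∂ν) atTop (𝓝 (∫ _, (0 : ℝ) ∂ν)) := by
      refine tendsto_integral_of_dominated_convergence (fun _ => C + C)
        (fun n => ((hkB.aestronglyMeasurable ν).sub ((hh n).aestronglyMeasurable ν)).norm)
        (integrable_const _) (fun n => Eventually.of_forall fun x => ?_)
        (Eventually.of_forall fun x => ?_)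
      · rw [norm_norm]
        exact (norm_sub_le _ _).trans (add_le_add
          (le_of_tendsto (hk x).norm (Eventually.of_forall fun n => hC n x)) (hC n x))
      · simpa using ((tendsto_const_nhds (x := k x)).sub (hk x)).norm
    rw [integral_zero] at hlim
    obtain ⟨n, hn⟩ := (hlim.eventually (gt_mem_nhds (half_pos hε))).exists
    obtain ⟨b, hb, hbn⟩ := ih n (half_pos hε)
    refine ⟨b, hb, ?_⟩
    have hkn := ((hkB.integrable ν).sub ((hh n).integrable ν)).norm
    have hnb := (((hh n).integrable ν).sub
      ((of (B := (B : Set C(X, ℂ))) b hb).integrable ν)).norm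
    calc ∫ x, ‖k x - b x‖ ∂ν ≤ ∫ x, (‖k x - h n x‖ + ‖h n x - b x‖) ∂ν := by
          refine integral_mono
            ((hkB.integrable ν).sub ((of (B := (B : Set C(X, ℂ))) b hb).integrable ν)).norm
            (hkn.add hnb) fun x => ?_
          simpa using norm_add_le (k x - h n x) (h n x - b x)
      _ = (∫ x, ‖k x - h n x‖ ∂ν) + ∫ x, ‖h n x - b x‖ ∂ν := integral_add hkn hnb
      _ < ε := by linarith

end BoundedPointwiseClosure

/-! ### Hahn–Banach, Riesz and the equality of the algebra with all continuous functions. -/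

/-- The uniform distance to a closed subspace is positive in the mean for some measure. -/
theorem exists_measure_le_integral_norm_sub {X : Type*} [TopologicalSpace X] [CompactSpace X]
    [T2Space X] [MeasurableSpace X] [BorelSpace X] {B : Subalgebra ℂ C(X, ℂ)}
    (hB : IsClosed (B : Set C(X, ℂ))) {φ : C(X, ℂ)} (hφ : φ ∉ B) :
    ∃ (ν : Measure X) (_ : IsFiniteMeasure ν) (u : ℝ), 0 < u ∧
      ∀ b ∈ B, u ≤ ∫ x, ‖φ x - b x‖ ∂ν := by
  obtain ⟨d, hd, hdB⟩ := Metric.isOpen_iff.1 hB.isOpen_compl φ hφ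
  let s : Set C(X, ℝ) := {g | ∀ x, g x < d}
  let t : Set C(X, ℝ) := {g | ∃ b ∈ B, ∀ x, ‖φ x - b x‖ ≤ g x}
  have hs : Convex ℝ s := by
    intro g hg k hk a b ha hb hab x
    have h1 : a • g x + b • k x ∈ Iio d := (convex_Iio d) (hg x) (hk x) ha hb hab
    exact h1
  have hso : IsOpen s := by
    have := ContinuousMap.isOpen_setOfPred_mapsTo (isCompact_univ (X := X)) (isOpen_Iio (a := d))
    convert this using 1
    ext g
    simp [s, MapsTo]
  have ht : Convex ℝ t := by
    rintro g ⟨p, hp, hpg⟩ k ⟨q, hq, hqk⟩ a b ha hb hab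
    refine ⟨(a : ℂ) • p + (b : ℂ) • q, B.add_mem (B.smul_mem hp _) (B.smul_mem hq _),
      fun x => ?_⟩
    have hab' : (a : ℂ) + b = 1 := by exact_mod_cast hab
    have h1 : φ x - ((a : ℂ) • p + (b : ℂ) • q) x
        = (a : ℂ) * (φ x - p x) + (b : ℂ) * (φ x - q x) := by
      simp only [ContinuousMap.add_apply, ContinuousMap.smul_apply, smul_eq_mul]
      linear_combination -(φ x) * hab'
    rw [h1]
    refine (norm_add_le _ _).trans ?_
    rw [norm_mul, norm_mul, Complex.norm_real, Complex.norm_real, Real.norm_of_nonneg ha,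
      Real.norm_of_nonneg hb]
    exact add_le_add (mul_le_mul_of_nonneg_left (hpg x) ha)
      (mul_le_mul_of_nonneg_left (hqk x) hb)
  have hst : Disjoint s t := by
    rw [Set.disjoint_left]
    rintro g hg ⟨b, hb, hbg⟩
    refine hdB ?_ hb
    rw [Metric.mem_ball, dist_comm, dist_eq_norm, ContinuousMap.norm_lt_iff _ hd]
    exact fun x => (hbg x).trans_lt (hg x)
  -- The set `s` is unbounded below, which makes the separating functional positive, and contains
  -- `0`, which makes `u` positive. On `t` the bound is exactly the required lower estimate.
  obtain ⟨F, u, hFs, hFt⟩ := geometric_hahn_banach_open hs hso ht hst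
  have hu : 0 < u := by simpa using hFs 0 fun x => hd
  have hpos : ∀ g : C(X, ℝ), 0 ≤ g → 0 ≤ F g := by
    intro g hg
    by_contra! hneg
    have h1 := hFs ((u / F g) • g) fun x => by
      have : u / F g * g x ≤ 0 :=
        mul_nonpos_of_nonpos_of_nonneg (div_nonpos_of_nonneg_of_nonpos hu.le hneg.le) (hg x)
      exact this.trans_lt hd
    rw [map_smul, smul_eq_mul, div_mul_cancel₀ _ hneg.ne] at h1
    exact lt_irrefl _ h1
  let Λ : CompactlySupportedContinuousMap X ℝ →ₚ[ℝ] ℝ := PositiveLinearMap.mk₀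
    { toFun := fun g => F g.toContinuousMap
      map_add' := fun g k => F.map_add g.toContinuousMap k.toContinuousMap
      map_smul' := fun c g => F.map_smul c g.toContinuousMap }
    fun g hg => hpos _ fun x => hg x
  refine ⟨RealRMK.rieszMeasure Λ, inferInstance, u, hu, fun b hb => ?_⟩
  let k : C(X, ℝ) := ⟨fun x => ‖φ x - b x‖, by fun_prop⟩
  have h1 := RealRMK.integral_rieszMeasure Λ (CompactlySupportedContinuousMap.continuousMapEquiv k)
  have h2 : u ≤ F k := hFt k ⟨b, hb, fun x => le_rfl⟩
  calc u ≤ F k := h2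
    _ = _ := h1.symm

/-- A closed separating algebra of continuous functions on a locally connected compact space in
which exponentials are dense contains all continuous functions. -/
theorem eq_top_of_dense_exponentials {X : Type*} [TopologicalSpace X] [CompactSpace X]
    [T2Space X] [LocallyConnectedSpace X] {B : Subalgebra ℂ C(X, ℂ)}
    (hB : IsClosed (B : Set C(X, ℂ))) (hsep : B.SeparatesPoints)
    (hd : ∀ f ∈ B, f ∈ closure (ContinuousMap.cexp '' expGenerators B)) : B = ⊤ := by
  rw [eq_top_iff]
  intro φ _
  by_contra hφ
  let : MeasurableSpace X := borel X
  have : BorelSpace X := ⟨rfl⟩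
  obtain ⟨ν, _, u, hu, hν⟩ := exists_measure_le_integral_norm_sub hB hφ
  have hφB : BoundedPointwiseClosure (B : Set C(X, ℂ)) φ := by
    refine .of_continuous (fun x y hxy => ?_) φ
    obtain ⟨G, hG, hGx, hGy⟩ := exists_mem_eventually_eq_zero_of_ne hB hsep hd hxy
    obtain ⟨h, hh, h1, hx, hz⟩ := exists_boundedPointwiseClosure_eq_one hd hG hGx
    refine ⟨_, hh.indicator_eq_one h1, hx, ?_⟩
    filter_upwards [hGy] with z hz' (h3 : h z = 1)
    rw [hz z hz'] at h3
    exact zero_ne_one h3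
  obtain ⟨b, hb, hlt⟩ := hφB.exists_integral_norm_sub_lt ν hu
  exact absurd (hν b hb) (not_le.2 hlt)

/-! ### Application to spaces of characters. -/

/-- On connected, locally connected compact spaces of characters, continuous functions can be
approximated by Gelfand transforms of invertible elements. -/
theorem denseNonvanishing_of_characters {A : Type*} [NormedCommRing A] [NormedAlgebra ℂ A]
    [CompleteSpace A] (hinv : Dense {a : A | IsUnit a}) (hsq : Dense (range fun a : A => a ^ 2))
    {X : Type*} [TopologicalSpace X] [CompactSpace X] [T2Space X] [ConnectedSpace X]
    [LocallyConnectedSpace X] (i : C(X, WeakDual.characterSpace ℂ A))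
    (hi : Function.Injective i) : DenseNonvanishing X := by
  let ρ : A →ₐ[ℂ] C(X, ℂ) :=
    (ContinuousMap.compRightAlgHom ℂ ℂ i).comp (WeakDual.gelfandTransform ℂ A)
  have hρ : ∀ a x, ρ a x = i x a := fun a x => rfl
  have hρc : Continuous ρ := by
    refine AddMonoidHomClass.continuous_of_bound ρ ‖(1 : A)‖ fun a => ?_
    refine (ContinuousMap.norm_le _ (by positivity)).2 fun x => ?_
    rw [hρ]
    exact ContinuousLinearMap.le_of_opNorm_le (WeakDual.toStrongDual (i x).1)
      (WeakDual.CharacterSpace.norm_le_norm_one (i x)) a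
  have hunit : ∀ a : A, IsUnit a → ∀ x, ρ a x ≠ 0 := fun a ha x => by
    rw [hρ]; exact (ha.map (i x)).ne_zero
  let B : Subalgebra ℂ C(X, ℂ) := ρ.range.topologicalClosure
  have hBcl : closure (range ρ) = (B : Set C(X, ℂ)) := rfl
  have hρB : ∀ a, ρ a ∈ B := fun a => subset_closure ⟨a, rfl⟩
  have hdense : (B : Set C(X, ℂ)) ⊆ closure (ρ '' {a | IsUnit a}) := by
    refine closure_minimal ?_ isClosed_closure
    rintro _ ⟨a, rfl⟩
    exact image_closure_subset_closure_image hρc ⟨a, hinv a, rfl⟩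
  have htop : B = ⊤ := by
    refine eq_top_of_dense_exponentials ρ.range.isClosed_topologicalClosure (fun x y hxy => ?_)
      fun f hf => closure_mono ?_ (hdense hf)
    · obtain ⟨a, ha⟩ : ∃ a, i x a ≠ i y a := by
        by_contra! h
        exact hxy (hi (DFunLike.ext _ _ h))
      exact ⟨_, ⟨ρ a, hρB a, rfl⟩, ha⟩
    · rintro _ ⟨a, ha, rfl⟩
      refine exists_mem_expGenerators_cexp_eq ρ.range.isClosed_topologicalClosure _
        (hunit a ha) fun n => ?_
      obtain ⟨r, hr⟩ := exists_two_pow_root_of_isUnit hsq n ha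
      exact ⟨ρ r, hρB r, by rw [← map_pow, hr]⟩
  intro f ε hε
  have hf : f ∈ closure (ρ '' {a | IsUnit a}) := hdense (by rw [htop]; trivial)
  obtain ⟨_, ⟨a, ha, rfl⟩, h⟩ := Metric.mem_closure_iff.1 hf ε hε
  refine ⟨ρ a, hunit a ha, fun x => ?_⟩
  rw [dist_comm, dist_eq_norm] at h
  exact ((ρ a - f).norm_coe_le_norm x).trans_lt h

theorem theorem3 (A : Type*) [NormedCommRing A] [NormedAlgebra ℂ A] [CompleteSpace A]
    (hinv : Dense {a : A | IsUnit a})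
    (hsq : Dense (Set.range fun a : A => a ^ 2)) :
    ¬ ∃ E : Set (WeakDual.characterSpace ℂ A),
      IsCompact E ∧ LocallyConnectedSpace E ∧ 2 ≤ coveringDimension E := by
  rintro ⟨E, hE, hloc, hdim⟩
  have : CompactSpace E := isCompact_iff_compactSpace.1 hE
  have hX : DenseNonvanishing E := by
    -- A component of `E` is closed, hence compact, and open, hence itself locally connected.
    refine .of_connectedComponent fun x => ?_
    have : CompactSpace (connectedComponent x) :=
      isCompact_iff_compactSpace.1 isClosed_connectedComponent.isCompact
    have : ConnectedSpace (connectedComponent x) :=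
      isConnected_iff_connectedSpace.1 isConnected_connectedComponent
    have : LocallyConnectedSpace (connectedComponent x) :=
      isOpen_connectedComponent.locallyConnectedSpace
    exact denseNonvanishing_of_characters hinv hsq
      ⟨fun y => (y : E).1, by fun_prop⟩ fun y z h => Subtype.ext (Subtype.ext h)
  have h := hdim.trans (coveringDimension_le_one hX.hasCoveringDimensionLT)
  exact absurd h (by decide)
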